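/- Let $f:\mathbb{R}\to\mathbb{C}$ be analytic and bounded on the real line, let $a>0$, and suppose that $e^{-x^2}f(x)$ extends to a bounded analytic function in the infinite strip $-a<\operatorname{Im} x<a$. Let $L>0$ be fixed. Put $$I=\int_{-\infty}^{\infty}e^{-x^2}f(x)\,dx,$$ and for each $n$ let $I_n$ be the estimate of $I$ obtained by applying to the function $e^{-x^2}f(x)$ one of the following $n$-point quadrature formulas, scaled linearly from $[-1,1]$ to the truncated interval $[-Ln^{1/3},Ln^{1/3}]$: - Gauss–Legendre quadrature (integrate the polynomial interpolant at the roots of the Legendre polynomial $P_n$); - Clenshaw–Curtis quadrature (integrate the polynomial interpolant at the Chebyshev points $\cos(j\pi/(n-1))$, $0\le j\le n-1$, $n\ge 2$); - trapezoidal quadrature (the $n$ equispaced points including both end points, $n\ge 2$, with equal weights except for half weights at the end points). Then there is a constant $C>0$ such that, for each of the three formulas, $$|I-I_n|=O\bigl(\exp(-Cn^{2/3})\bigr),\qquad n\to\infty.$$ -/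

import Mathlib

open MeasureTheory Filter Asymptotics

namespace TruncatedQuadrature

noncomputable section

/-- The interpolatory quadrature rule on `[-1, 1]` with node set `s`: the weight of the node `x` is
the integral over `[-1, 1]` of the Lagrange basis polynomial of `x`, so the value of the rule is the
integral of the polynomial of degree less than `#s` that interpolates `g` at the points of `s`. -/
def interpolatory (s : Finset ℝ) (g : ℝ → ℂ) : ℂ :=
  ∑ x ∈ s, (∫ t in (-1 : ℝ)..1, (Lagrange.basis s id x).eval t) • g x

/-- The Legendre polynomial `P_n`, by the Rodrigues formula
`P_n = (1 / (2 ^ n n!)) (d / dx) ^ n (x ^ 2 - 1) ^ n`. -/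
def legendre (n : ℕ) : Polynomial ℝ :=
  Polynomial.C ((2 ^ n * (n.factorial : ℝ))⁻¹) *
    Polynomial.derivative^[n] ((Polynomial.X ^ 2 - 1) ^ n)

/-- The `n`-point Gauss-Legendre rule on `[-1, 1]`: the nodes are the roots of `P_n`. -/
def gaussLegendre (n : ℕ) (g : ℝ → ℂ) : ℂ :=
  interpolatory (legendre n).roots.toFinset g

/-- The Chebyshev points `cos (j π / (n - 1))`, `0 ≤ j ≤ n - 1` (meaningful for `n ≥ 2`). -/
def chebyshevPoints (n : ℕ) : Finset ℝ :=
  (Finset.range n).image fun j : ℕ => Real.cos ((j : ℝ) * Real.pi / ((n : ℝ) - 1))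

/-- The `n`-point Clenshaw-Curtis rule on `[-1, 1]`: integrate the polynomial interpolant of degree
at most `n - 1` through the `n` Chebyshev points (meaningful for `n ≥ 2`). -/
def clenshawCurtis (n : ℕ) (g : ℝ → ℂ) : ℂ :=
  interpolatory (chebyshevPoints n) g

/-- The `n`-point trapezoidal rule on `[-1, 1]` (meaningful for `n ≥ 2`): the nodes are the `n`
equispaced points `-1 + j h`, `0 ≤ j ≤ n - 1`, with step `h = 2 / (n - 1)`, and the weights are `h`
at the interior nodes and `h / 2` at the two end points. -/
def trapezoidal (n : ℕ) (g : ℝ → ℂ) : ℂ :=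
  ∑ j ∈ Finset.range n,
    ((2 / ((n : ℝ) - 1)) * (if j = 0 ∨ j = n - 1 then (1 / 2 : ℝ) else 1)) •
      g (-1 + (j : ℝ) * (2 / ((n : ℝ) - 1)))

/-- A quadrature rule `Q` on `[-1, 1]` transplanted to the interval `[-R, R]` by the scaling
`t ↦ R t`: nodes and weights are multiplied by `R`. -/
def onInterval (Q : (ℝ → ℂ) → ℂ) (R : ℝ) (g : ℝ → ℂ) : ℂ :=
  R • Q fun t => g (R * t)

end

end TruncatedQuadrature

namespace TruncatedQuadrature

/-! Write `G` for the extension of `e^{-x²} f` and `R = L n^{1/3}`. Two errors compete. Truncation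
to `[-R, R]` costs `O(e^{-R²/2})`, that is `e^{-c n^{2/3}}`, by the Gaussian factor
(`norm_integral_sub_intervalIntegral_le`). Discretization is governed by the density `n / R` of the
nodes against the width of the strip and costs about `e^{-c n/R}`, again with exponent of order
`n^{2/3}`. The power `1/3` balances the two.

For the interpolatory rules, `w ↦ G(R cos w)` is analytic and periodic in a strip of half-width
about `a/R`, so its Fourier coefficients, which are Chebyshev coefficients of `t ↦ G(R t)`, decay
like `e^{-c|k|/R}` (`exists_chebyshev_approx`). An `n`-point rule is exact below degree `n`, so its
error is the approximation error times a bound for the sum of absolute weights: `2` for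
Gauss–Legendre, `2n²` for Clenshaw–Curtis. Polynomial factors are absorbed by lowering the rate.

For the trapezoidal rule, Poisson summation bounds the error on the whole line by Fourier
coefficients at nonzero frequencies (`norm_tsum_sub_integral_le`). Shifting contours there needs
integrable decay off the real axis, whereas `G` is only assumed bounded;
`norm_le_of_gaussian_on_real` supplies it by Phragmén–Lindelöf. -/

/-! ### Gaussian decay off the real axis -/

/-- Phragmén–Lindelöf is applied to `G e^q` with `q = z² + i z³/(3b)`. The cubic term makes the
coefficient of `x²` in `Re q` equal to `1 - y/b`: on the real axis `e^q` cancels the Gaussian, on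
`Im z = b` it is bounded by `1`, and for `y ≤ b/2` at least half of the Gaussian survives. -/
theorem norm_le_of_gaussian_on_real_upper {G : ℂ → ℂ} {a b M : ℝ} (hb : 0 < b) (hba : b < a)
    (hG : DifferentiableOn ℂ G {z : ℂ | |z.im| < a}) (hM : ∀ z : ℂ, |z.im| < a → ‖G z‖ ≤ M)
    (hreal : ∀ x : ℝ, ‖G x‖ ≤ M * Real.exp (-x ^ 2)) {z : ℂ} (h0 : 0 ≤ z.im) (h1 : z.im ≤ b / 2) :
    ‖G z‖ ≤ M * Real.exp (b ^ 2) * Real.exp (-z.re ^ 2 / 2) := by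
  have hM0 : 0 ≤ M := (norm_nonneg _).trans (hM 0 (by simpa using hb.trans hba))
  set q : ℂ → ℂ := fun z => z ^ 2 + Complex.I * z ^ 3 / (3 * b) with hq
  have hqre : ∀ z : ℂ, (q z).re =
      z.re ^ 2 * (1 - z.im / b) - z.im ^ 2 + z.im ^ 3 / (3 * b) := by
    intro z
    have : q z = z ^ 2 + Complex.I * z ^ 3 * ((1 / (3 * b) : ℝ) : ℂ) := by
      simp only [hq]; push_cast; ring
    rw [this]
    simp only [pow_succ, pow_zero, one_mul, Complex.add_re, Complex.mul_re, Complex.mul_im,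
      Complex.I_re, Complex.I_im, Complex.ofReal_re, Complex.ofReal_im]
    field_simp
    ring
  have hcub : ∀ y : ℝ, 0 ≤ y → y ≤ b → - y ^ 2 + y ^ 3 / (3 * b) ≤ 0 := by
    intro y hy hyb
    have : y ^ 3 / (3 * b) ≤ y ^ 2 := by
      rw [div_le_iff₀ (by positivity)]
      nlinarith [mul_le_mul_of_nonneg_left hyb (sq_nonneg y), sq_nonneg y, mul_nonneg (sq_nonneg y) hb.le]
    linarith
  have key : ‖G z * Complex.exp (q z)‖ ≤ M := by
    apply PhragmenLindelof.horizontal_strip (f := fun z => G z * Complex.exp (q z)) (a := 0) (b := b)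
    · apply DifferentiableOn.diffContOnCl
      rw [Complex.closure_preimage_im, closure_Ioo hb.ne]
      refine DifferentiableOn.mul (hG.mono ?_) (by fun_prop)
      intro w hw
      simp only [Set.mem_preimage, Set.mem_Icc] at hw
      simp only [Set.mem_ofPred_eq, abs_lt]
      constructor <;> linarith
    -- Any growth exponent below `π/b` is allowed. With `1/b`, the bound `u²/2 ≤ e^u` at `u = |x|/b`
    -- gives `x² ≤ 2b² e^{|x|/b}`.
    · refine ⟨1 / b, ?_, 2 * b ^ 2, ?_⟩
      · rw [sub_zero]
        gcongr
        linarith [Real.pi_gt_three]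
      · apply IsBigO.of_bound M
        refine eventually_inf_principal.2 (Eventually.of_forall fun w hw => ?_)
        simp only [Set.mem_preimage, Set.mem_Ioo] at hw
        rw [norm_mul, Complex.norm_exp, hqre, Real.norm_eq_abs, Real.abs_exp]
        refine mul_le_mul (hM w (abs_lt.2 ⟨by linarith, by linarith⟩)) (Real.exp_le_exp.2 ?_)
          (Real.exp_nonneg _) hM0
        have h2 := hcub w.im hw.1.le hw.2.le
        have h3 : w.re ^ 2 * (1 - w.im / b) ≤ w.re ^ 2 := by
          have : 0 ≤ w.im / b := div_nonneg hw.1.le hb.le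
          nlinarith [sq_nonneg w.re]
        have h4 := Real.quadratic_le_exp_of_nonneg (x := 1 / b * |w.re|) (by positivity)
        have h5 : (1 / b * |w.re|) ^ 2 = w.re ^ 2 / b ^ 2 := by
          rw [mul_pow, sq_abs]; ring
        have h6 : w.re ^ 2 / b ^ 2 / 2 ≤ Real.exp (1 / b * |w.re|) := by
          rw [h5] at h4
          have : 0 ≤ 1 / b * |w.re| := by positivity
          linarith
        rw [div_div, div_le_iff₀ (by positivity)] at h6
        linarith
    · intro w hw
      have hw' : w = (w.re : ℂ) := by apply Complex.ext <;> simp [hw]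
      rw [norm_mul, Complex.norm_exp, hqre, hw]
      have := hreal w.re
      rw [← hw'] at this
      calc _ ≤ M * Real.exp (-w.re ^ 2) * Real.exp (w.re ^ 2 * (1 - 0 / b) - 0 ^ 2 + 0 ^ 3 / (3 * b)) := by
            gcongr
        _ = M := by rw [mul_assoc, ← Real.exp_add]; simp
    · intro w hw
      rw [norm_mul, Complex.norm_exp, hqre, hw]
      calc _ ≤ M * 1 := by
            refine mul_le_mul (hM w (by rw [hw, abs_of_pos hb]; exact hba)) ?_ (Real.exp_nonneg _) hM0
            rw [Real.exp_le_one_iff, div_self hb.ne']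
            linarith [hcub b hb.le le_rfl]
        _ = M := mul_one M
    · exact h0
    · linarith
  rw [norm_mul, Complex.norm_exp, hqre] at key
  rw [mul_assoc, ← Real.exp_add, ← div_le_iff₀ (Real.exp_pos _), div_eq_mul_inv, ← Real.exp_neg]
  refine le_trans ?_ key
  gcongr
  have h3 : z.re ^ 2 / 2 ≤ z.re ^ 2 * (1 - z.im / b) := by
    have : z.im / b ≤ 1 / 2 := by rw [div_le_iff₀ hb]; linarith
    nlinarith [sq_nonneg z.re]
  have h4 : 0 ≤ z.im ^ 3 / (3 * b) := by positivity
  have h5 : z.im ^ 2 ≤ b ^ 2 := by gcongr; linarith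
  linarith

/-- A bounded analytic function on a strip with Gaussian decay on the real line decays like a
wider Gaussian on a smaller strip. -/
theorem norm_le_of_gaussian_on_real {G : ℂ → ℂ} {a b M : ℝ} (hb : 0 < b) (hba : b < a)
    (hG : DifferentiableOn ℂ G {z : ℂ | |z.im| < a}) (hM : ∀ z : ℂ, |z.im| < a → ‖G z‖ ≤ M)
    (hreal : ∀ x : ℝ, ‖G x‖ ≤ M * Real.exp (-x ^ 2)) {z : ℂ} (hz : |z.im| ≤ b / 2) :
    ‖G z‖ ≤ M * Real.exp (b ^ 2) * Real.exp (-z.re ^ 2 / 2) := by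
  rcases le_total 0 z.im with h | h
  · exact norm_le_of_gaussian_on_real_upper hb hba hG hM hreal h (by rwa [abs_of_nonneg h] at hz)
  · have := norm_le_of_gaussian_on_real_upper (G := fun z => G (-z)) (z := -z) hb hba
      (hG.comp (by fun_prop) (fun w hw => by simpa using hw))
      (fun w hw => hM _ (by simpa using hw))
      (fun x => by simpa using hreal (-x)) (by simpa using h)
      (by simpa [abs_of_nonpos h] using hz)
    simpa using this

/-! ### Two-sided geometric series -/

theorem hasSum_int_geometric {r : ℝ} (h0 : 0 ≤ r) (h1 : r < 1) :
    HasSum (fun k : ℤ => r ^ k.natAbs) ((1 + r) / (1 - r)) := by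
  have h := hasSum_geometric_of_lt_one h0 h1
  have h2 : HasSum (fun n : ℕ => r ^ (-((n : ℤ) + 1)).natAbs) (r * (1 - r)⁻¹) := by
    have h3 : (fun n : ℕ => r ^ (-((n : ℤ) + 1)).natAbs) = fun n : ℕ => r * r ^ n := by
      funext n
      rw [← pow_succ']
      congr 1
    rw [h3]
    exact h.mul_left r
  convert HasSum.of_nat_of_neg_add_one (f := fun k : ℤ => r ^ k.natAbs) (by simpa using h) h2 using 1
  have : 1 - r ≠ 0 := by linarith
  field_simp

theorem tsum_int_geometric_le {r : ℝ} (h0 : 0 ≤ r) (h1 : r < 1) :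
    ∑' k : ℤ, r ^ k.natAbs ≤ 2 / (1 - r) := by
  rw [(hasSum_int_geometric h0 h1).tsum_eq]
  have : 0 < 1 - r := by linarith
  gcongr
  linarith

theorem summable_of_norm_le_geometric {c : ℤ → ℂ} {A s : ℝ} (h0 : 0 ≤ s) (h1 : s < 1)
    (hc : ∀ k, ‖c k‖ ≤ A * s ^ (2 * k.natAbs)) : Summable c := by
  refine Summable.of_norm_bounded (g := fun k : ℤ => A * (s ^ 2) ^ k.natAbs) ?_ fun k => ?_
  · exact (hasSum_int_geometric (by positivity) (by nlinarith)).summable.mul_left A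
  · simpa [pow_mul] using hc k

/-- Tail bound for a two-sided series with geometrically decaying terms. -/
theorem norm_tsum_sub_sum_le {c : ℤ → ℂ} {A s : ℝ} (h0 : 0 ≤ s) (h1 : s < 1) (hA : 0 ≤ A)
    (hc : ∀ k, ‖c k‖ ≤ A * s ^ (2 * k.natAbs)) (n : ℕ) :
    ‖∑' k, c k - ∑ k ∈ Finset.Ioo (-(n : ℤ)) n, c k‖ ≤ A * s ^ n * (2 / (1 - s)) := by
  classical
  have hs := summable_of_norm_le_geometric h0 h1 hc
  have hg := (hasSum_int_geometric h0 h1).summable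
  rw [← Summable.sum_add_tsum_compl (s := Finset.Ioo (-(n : ℤ)) n) (hf := hs), add_sub_cancel_left,
    tsum_subtype]
  -- Outside the window `|k| ≥ n`, so `s^{2|k|} ≤ s^n s^{|k|}`: half of the decay gives the rate,
  -- the other half keeps the tail summable.
  calc _ ≤ ∑' k : ℤ, A * s ^ n * s ^ k.natAbs := by
        refine tsum_of_norm_bounded (hg.mul_left _).hasSum fun k => ?_
        by_cases hk : k ∈ Finset.Ioo (-(n : ℤ)) n
        · rw [Set.indicator_of_notMem (by simpa using hk), norm_zero]
          positivity
        · rw [Set.indicator_of_mem (by simpa using hk)]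
          refine (hc k).trans ?_
          rw [mul_assoc, ← pow_add]
          gcongr A * ?_
          apply pow_le_pow_of_le_one h0 h1.le
          rw [Finset.mem_Ioo] at hk
          omega
    _ = A * s ^ n * ∑' k : ℤ, s ^ k.natAbs := tsum_mul_left
    _ ≤ _ := by
        gcongr
        exact tsum_int_geometric_le h0 h1

/-! ### Chebyshev approximation of functions analytic in a strip -/

/-- Cauchy's theorem on a rectangle of width one period: the vertical sides cancel. -/
theorem integral_periodic_eq_integral_shift {f : ℂ → ℂ} {η σ : ℝ}
    (hf : DifferentiableOn ℂ f {z : ℂ | |z.im| ≤ η}) (hσ : |σ| ≤ η)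
    (hp : ∀ z, f (z + 2 * Real.pi) = f z) :
    ∫ x in (0 : ℝ)..2 * Real.pi, f x = ∫ x in (0 : ℝ)..2 * Real.pi, f (x + σ * Complex.I) := by
  have h := Complex.integral_boundary_rect_eq_zero_of_differentiableOn f (σ * Complex.I)
    ((2 * Real.pi : ℝ) : ℂ) (hf.mono ?_)
  · have hv : ∀ y : ℝ, f (((2 * Real.pi : ℝ) : ℂ) + y * Complex.I) = f (y * Complex.I) := by
      intro y
      rw [← hp (y * Complex.I)]
      push_cast
      ring_nf
    simp only [Complex.mul_re, Complex.mul_im, Complex.ofReal_re, Complex.ofReal_im, Complex.I_re,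
      Complex.I_im, mul_zero, mul_one, zero_mul, add_zero, sub_zero, Complex.ofReal_zero,
      hv, zero_add] at h
    rw [add_sub_cancel_right, sub_eq_zero] at h
    exact h.symm
  · rintro w ⟨-, hw⟩
    simp only [Set.mem_preimage, Complex.mul_im, Complex.ofReal_re, Complex.I_im, mul_one,
      Complex.ofReal_im, Complex.I_re, mul_zero, add_zero] at hw
    have := Set.abs_sub_le_of_uIcc_subset_uIcc (Set.uIcc_subset_uIcc hw Set.right_mem_uIcc)
    simp at this
    exact this.trans hσ

theorem norm_fourier_integral_le {F : ℂ → ℂ} {η M : ℝ} (hη : 0 ≤ η)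
    (hF : DifferentiableOn ℂ F {z : ℂ | |z.im| ≤ η}) (hM : ∀ z : ℂ, |z.im| ≤ η → ‖F z‖ ≤ M)
    (hp : ∀ z, F (z + 2 * Real.pi) = F z) (k : ℤ) :
    ‖∫ x in (0 : ℝ)..2 * Real.pi, Complex.exp (-(Complex.I * k * x)) * F x‖ ≤
      2 * Real.pi * (M * Real.exp (-(η * k.natAbs))) := by
  -- The contour moves towards the side where `|e^{-ikz}| = e^{k Im z}` decreases, which depends on
  -- the sign of `k`.
  obtain ⟨σ, hσ, hσk⟩ : ∃ σ : ℝ, |σ| ≤ η ∧ k * σ = -(η * k.natAbs) := by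
    rcases le_total 0 k with h | h
    · refine ⟨-η, by rw [abs_neg, abs_of_nonneg hη], ?_⟩
      rw [Nat.cast_natAbs, abs_of_nonneg h]; ring
    · refine ⟨η, by rw [abs_of_nonneg hη], ?_⟩
      rw [Nat.cast_natAbs, abs_of_nonpos h]; push_cast; ring
  rw [integral_periodic_eq_integral_shift (f := fun z => Complex.exp (-(Complex.I * k * z)) * F z)
    (η := η) (σ := σ) (DifferentiableOn.mul (by fun_prop) hF) hσ]
  · refine (intervalIntegral.norm_integral_le_of_norm_le_const (C := M * Real.exp (-(η * k.natAbs)))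
      fun x _ => ?_).trans_eq ?_
    · rw [norm_mul, mul_comm, Complex.norm_exp]
      refine mul_le_mul (hM _ (by simpa using hσ)) (le_of_eq ?_) (Real.exp_nonneg _)
        ((norm_nonneg _).trans (hM 0 (by simpa using hη)))
      rw [← hσk]
      simp
    · rw [sub_zero, abs_of_pos Real.two_pi_pos]; ring
  · intro z
    rw [hp]
    congr 1
    rw [show -(Complex.I * k * (z + 2 * Real.pi)) =
      -(Complex.I * k * z) + ((-k : ℤ) : ℂ) * (2 * Real.pi * Complex.I) by push_cast; ring,
      Complex.exp_add, Complex.exp_int_mul_two_pi_mul_I, mul_one]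

open Polynomial.Chebyshev in
/-- Geometric convergence of Chebyshev series: a function bounded and analytic in a strip is
approximated on `[-R, R]` by combinations of `T_k (t / R)`, `|k| < n`. -/
theorem exists_chebyshev_approx {G : ℂ → ℂ} {a M R η : ℝ} (hR : 0 ≤ R) (hη : 0 < η)
    (hRη : R * Real.sinh η < a) (hG : DifferentiableOn ℂ G {z : ℂ | |z.im| < a})
    (hM : ∀ z : ℂ, |z.im| < a → ‖G z‖ ≤ M) :
    ∃ c : ℤ → ℂ, ∀ n : ℕ, ∀ t ∈ Set.Icc (-1 : ℝ) 1,
      ‖G ((R * t : ℝ) : ℂ) - ∑ k ∈ Finset.Ioo (-(n : ℤ)) n, c k * ((T ℝ k).eval t : ℝ)‖ ≤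
        M * Real.exp (-(η / 2)) ^ n * (2 / (1 - Real.exp (-(η / 2)))) := by
  have ha : 0 < a := lt_of_le_of_lt (mul_nonneg hR (Real.sinh_nonneg_iff.2 hη.le)) hRη
  have hM0 : 0 ≤ M := (norm_nonneg _).trans (hM 0 (by simpa using ha))
  -- The substitution `t = cos w` turns Chebyshev series into Fourier series. Since `|Im (R cos w)|
  -- ≤ R sinh |Im w|`, the strip `|Im w| ≤ η` is mapped into the domain of `G`.
  set F : ℂ → ℂ := fun w => G (R * Complex.cos w) with hFdef
  have hmem : ∀ w : ℂ, |w.im| ≤ η → |(R * Complex.cos w).im| < a := by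
    intro w hw
    have h1 : (Complex.cos w).im = -(Real.sin w.re * Real.sinh w.im) := by
      conv_lhs => rw [← Complex.re_add_im w, Complex.cos_add_mul_I]
      simp [← Complex.ofReal_cos, ← Complex.ofReal_sin, ← Complex.ofReal_cosh,
        ← Complex.ofReal_sinh]
    rw [Complex.im_ofReal_mul, h1, abs_mul, abs_of_nonneg hR, abs_neg, abs_mul, Real.abs_sinh]
    refine lt_of_le_of_lt (mul_le_mul_of_nonneg_left ?_ hR) hRη
    refine (mul_le_of_le_one_left (Real.sinh_nonneg_iff.2 (abs_nonneg _))
      (Real.abs_sin_le_one _)).trans (Real.sinh_le_sinh.2 hw)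
  have hFd : DifferentiableOn ℂ F {z : ℂ | |z.im| ≤ η} :=
    hG.comp (by fun_prop) fun w hw => hmem w hw
  have hFM : ∀ w : ℂ, |w.im| ≤ η → ‖F w‖ ≤ M := fun w hw => hM _ (hmem w hw)
  have hFp : ∀ w, F (w + 2 * Real.pi) = F w := fun w => by simp [hFdef, Complex.cos_add_two_pi]
  have : Fact (0 < 2 * Real.pi) := ⟨Real.two_pi_pos⟩
  have hper : Function.Periodic (fun x : ℝ => F x) (2 * Real.pi) := fun x => by
    have := hFp x
    push_cast
    exact this
  have hcont : Continuous fun x : ℝ => F x := by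
    refine hFd.continuousOn.comp_continuous Complex.continuous_ofReal fun x => ?_
    simpa using hη.le
  set φ : C(AddCircle (2 * Real.pi), ℂ) := ⟨hper.lift, continuous_coinduced_dom.mpr hcont⟩
  have hφ : ∀ x : ℝ, φ x = F x := fun x => rfl
  set c : ℤ → ℂ := fourierCoeff φ with hc
  have hck : ∀ k, ‖c k‖ ≤ M * Real.exp (-(η / 2)) ^ (2 * k.natAbs) := by
    intro k
    have h := norm_fourier_integral_le hη.le hFd hFM hFp k
    rw [hc, fourierCoeff_eq_intervalIntegral _ _ 0, norm_smul, zero_add]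
    have h2 : ∀ x : ℝ, fourier (-k) (x : AddCircle (2 * Real.pi)) • φ x =
        Complex.exp (-(Complex.I * k * x)) * F x := by
      intro x
      rw [fourier_coe_apply, hφ, smul_eq_mul]
      congr 2
      have : (Real.pi : ℂ) ≠ 0 := by exact_mod_cast Real.pi_ne_zero
      push_cast
      field_simp
    simp_rw [h2]
    rw [Real.norm_of_nonneg (by positivity), ← Real.exp_nat_mul]
    rw [one_div_mul_eq_div, div_le_iff₀' Real.two_pi_pos]
    refine h.trans_eq ?_
    congr 3
    push_cast
    ring
  have hs1 : Real.exp (-(η / 2)) < 1 := by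
    rw [Real.exp_lt_one_iff]; linarith
  refine ⟨c, fun n t ht => ?_⟩
  have hsum := summable_of_norm_le_geometric (Real.exp_nonneg _) hs1 hck
  obtain ⟨θ, rfl⟩ : ∃ θ : ℝ, Real.cos θ = t := ⟨Real.arccos t, Real.cos_arccos ht.1 ht.2⟩
  have hF1 := has_pointwise_sum_fourier_series_of_summable hsum (θ : AddCircle (2 * Real.pi))
  have hF2 := has_pointwise_sum_fourier_series_of_summable hsum ((-θ : ℝ) : AddCircle (2 * Real.pi))
  have hpi : (Real.pi : ℂ) ≠ 0 := by exact_mod_cast Real.pi_ne_zero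
  -- `F` is even, so averaging its Fourier series at `θ` and `-θ` replaces `e^{ikθ}` by `cos kθ =
  -- T_k(cos θ)`.
  have hcos : HasSum (fun k : ℤ => c k * ((T ℝ k).eval (Real.cos θ) : ℝ)) (F θ) := by
    have h := (hF1.add hF2).mul_left (1 / 2 : ℂ)
    rw [hφ, hφ] at h
    have e1 : (1 / 2 : ℂ) * (F θ + F ((-θ : ℝ) : ℂ)) = F θ := by
      simp only [hFdef, Complex.ofReal_neg, Complex.cos_neg]; ring
    rw [e1] at h
    suffices hterm : ∀ k : ℤ, c k * ((T ℝ k).eval (Real.cos θ) : ℝ) = (1 / 2 : ℂ) *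
        (fourierCoeff φ k • fourier k (θ : AddCircle (2 * Real.pi)) +
          fourierCoeff φ k • fourier k ((-θ : ℝ) : AddCircle (2 * Real.pi))) by
      simpa only [hterm] using h
    intro k
    rw [fourier_coe_apply, fourier_coe_apply, T_real_cos, Complex.ofReal_cos, Complex.cos,
      smul_eq_mul, smul_eq_mul, ← mul_add, mul_left_comm, ← hc]
    congr 1
    rw [div_eq_inv_mul, one_div]
    congr 3
    · push_cast; field_simp
    · push_cast; field_simp
  have hFθ : F θ = G ((R * Real.cos θ : ℝ) : ℂ) := by simp [hFdef]
  rw [← hFθ, ← hcos.tsum_eq]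
  refine norm_tsum_sub_sum_le (Real.exp_nonneg _) hs1 hM0 (fun k => ?_) n
  rw [norm_mul]
  refine (mul_le_of_le_one_right (norm_nonneg _) ?_).trans (hck k)
  rw [T_real_cos, Complex.norm_real]
  exact Real.abs_cos_le_one _

/-! ### Error of interpolatory rules -/

open Polynomial in
theorem interpolatory_eval {s : Finset ℝ} {p : ℝ[X]} (hp : p.degree < s.card) :
    interpolatory s (fun t => ((p.eval t : ℝ) : ℂ)) = ((∫ t in (-1 : ℝ)..1, p.eval t : ℝ) : ℂ) := by
  have h := Lagrange.eq_interpolate (s := s) (v := id) Function.injective_id.injOn hp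
  conv_rhs => rw [h, Lagrange.interpolate_apply]
  simp only [eval_finsetSum, eval_mul, eval_C, interpolatory]
  rw [intervalIntegral.integral_finsetSum fun i _ => by
    apply Continuous.intervalIntegrable; fun_prop]
  push_cast
  refine Finset.sum_congr rfl fun x _ => ?_
  rw [intervalIntegral.integral_const_mul]
  simp [id, mul_comm]

theorem interpolatory_sub (s : Finset ℝ) (g h : ℝ → ℂ) :
    interpolatory s (fun t => g t - h t) = interpolatory s g - interpolatory s h := by
  simp [interpolatory, smul_sub, Finset.sum_sub_distrib]

theorem interpolatory_sum_mul {ι : Type*} (s : Finset ℝ) (u : Finset ι) (c : ι → ℂ)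
    (g : ι → ℝ → ℂ) : interpolatory s (fun t => ∑ k ∈ u, c k * g k t) =
      ∑ k ∈ u, c k * interpolatory s (g k) := by
  simp only [interpolatory, Finset.mul_sum, Finset.smul_sum]
  rw [Finset.sum_comm]
  refine Finset.sum_congr rfl fun k _ => Finset.sum_congr rfl fun x _ => ?_
  simp only [Complex.real_smul]
  ring

theorem norm_interpolatory_le {s : Finset ℝ} {g : ℝ → ℂ} {ε W : ℝ} (hε : 0 ≤ ε)
    (hg : ∀ t ∈ s, ‖g t‖ ≤ ε)
    (hW : ∑ x ∈ s, |∫ t in (-1 : ℝ)..1, (Lagrange.basis s id x).eval t| ≤ W) :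
    ‖interpolatory s g‖ ≤ W * ε := by
  refine (norm_sum_le _ _).trans (le_trans ?_ (mul_le_mul_of_nonneg_right hW hε))
  rw [Finset.sum_mul]
  refine Finset.sum_le_sum fun x hx => ?_
  rw [norm_smul, Real.norm_eq_abs]
  exact mul_le_mul_of_nonneg_left (hg x hx) (abs_nonneg _)

open Polynomial.Chebyshev in
/-- The error of an interpolatory rule on `[-1, 1]` is controlled by Chebyshev approximation and by
the sum of the absolute values of the weights. -/
theorem norm_integral_sub_interpolatory_le {s : Finset ℝ} {g : ℝ → ℂ} {c : ℤ → ℂ} {ε W : ℝ}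
    (hs : ∀ x ∈ s, x ∈ Set.Icc (-1 : ℝ) 1) (hgc : Continuous g) (hε : 0 ≤ ε)
    (hg : ∀ t ∈ Set.Icc (-1 : ℝ) 1,
      ‖g t - ∑ k ∈ Finset.Ioo (-(s.card : ℤ)) s.card, c k * ((T ℝ k).eval t : ℝ)‖ ≤ ε)
    (hW : ∑ x ∈ s, |∫ t in (-1 : ℝ)..1, (Lagrange.basis s id x).eval t| ≤ W) :
    ‖(∫ t in (-1 : ℝ)..1, g t) - interpolatory s g‖ ≤ (2 + W) * ε := by
  set p : ℝ → ℂ := fun t => ∑ k ∈ Finset.Ioo (-(s.card : ℤ)) s.card, c k * ((T ℝ k).eval t : ℝ)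
  have hpc : Continuous p := by fun_prop
  have hp : interpolatory s p = ∫ t in (-1 : ℝ)..1, p t := by
    rw [interpolatory_sum_mul, intervalIntegral.integral_finsetSum fun i _ => by
      apply Continuous.intervalIntegrable; fun_prop]
    refine Finset.sum_congr rfl fun k hk => ?_
    rw [intervalIntegral.integral_const_mul, interpolatory_eval, intervalIntegral.integral_ofReal]
    rw [degree_T, Nat.cast_lt]
    rw [Finset.mem_Ioo] at hk
    omega
  -- The rule is exact on `p`, so only `g - p` matters: the integral contributes `2ε` and the rule
  -- at most `Wε`.
  have e : (∫ t in (-1 : ℝ)..1, g t) - interpolatory s g =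
      (∫ t in (-1 : ℝ)..1, (g t - p t)) - interpolatory s (fun t => g t - p t) := by
    rw [interpolatory_sub, hp, intervalIntegral.integral_sub (hgc.intervalIntegrable _ _)
      (hpc.intervalIntegrable _ _)]
    ring
  rw [e, add_mul]
  refine (norm_sub_le _ _).trans (add_le_add ?_
    (norm_interpolatory_le hε (fun t ht => hg t (hs t ht)) hW))
  refine (intervalIntegral.norm_integral_le_of_norm_le_const fun t ht => ?_).trans_eq
    (?_ : ε * |1 - (-1)| = _)
  · rw [Set.uIoc_of_le (by norm_num)] at ht
    exact hg t ⟨ht.1.le, ht.2⟩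
  · norm_num [mul_comm]

/-- Keeps the constant of the geometric tail of order `1/η`; with `η` proportional to `1/R` this is
only a factor `R`. -/
theorem exp_half_geometric_le {η : ℝ} (h0 : 0 < η) (h1 : η ≤ 1) :
    2 / (1 - Real.exp (-(η / 2))) ≤ 8 / η := by
  have h2 : Real.exp (-(η / 2)) ≤ 1 - η / 4 := by
    have h3 := Real.add_one_le_exp (η / 2)
    rw [Real.exp_neg, inv_le_comm₀ (Real.exp_pos _) (by linarith)]
    refine le_trans ?_ h3
    rw [inv_le_iff_one_le_mul₀ (by linarith)]
    nlinarith
  rw [div_le_div_iff₀ (by linarith) h0]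
  linarith

/-- Quadrature error on `[-R, R]` for a function bounded and analytic in a strip. -/
theorem norm_integral_sub_onInterval_le {G : ℂ → ℂ} {a M R W : ℝ} {s : Finset ℝ} (ha : 0 < a)
    (hR : a ≤ R) (hG : DifferentiableOn ℂ G {z : ℂ | |z.im| < a})
    (hM : ∀ z : ℂ, |z.im| < a → ‖G z‖ ≤ M) (hs : ∀ x ∈ s, x ∈ Set.Icc (-1 : ℝ) 1)
    (hW0 : 0 ≤ W)
    (hW : ∑ x ∈ s, |∫ t in (-1 : ℝ)..1, (Lagrange.basis s id x).eval t| ≤ W) :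
    ‖(∫ x in (-R)..R, G x) - onInterval (interpolatory s) R (fun x : ℝ => G x)‖ ≤
      16 * M / a * (2 + W) * R ^ 2 * Real.exp (-(a / (4 * R)) * s.card) := by
  have hR0 : 0 < R := ha.trans_le hR
  have hM0 : 0 ≤ M := (norm_nonneg _).trans (hM 0 (by simpa using ha))
  -- For `0 < η ≤ 1` one has `sinh η < 2η`, so this choice gives `R sinh η < a`. The rate `e^{-η/2}`
  -- per degree becomes `e^{-a/(4R)}`.
  set η := a / (2 * R) with hη
  have hη0 : 0 < η := by positivity
  have hη1 : η ≤ 1 := by rw [hη, div_le_one (by positivity)]; linarith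
  have hsinh : Real.sinh η < 2 * η := by
    have h1 := (abs_le.1 (Real.abs_exp_sub_one_sub_id_le (x := η) (by rwa [abs_of_pos hη0]))).2
    have h2 := Real.one_sub_le_exp_neg η
    rw [Real.sinh_eq]
    nlinarith
  obtain ⟨c, hc⟩ := exists_chebyshev_approx (R := R) hR0.le hη0 (a := a) (by
    calc R * Real.sinh η < R * (2 * η) := by gcongr
      _ = a := by rw [hη]; field_simp) hG hM
  have hcont : Continuous fun x : ℝ => G x := by
    refine hG.continuousOn.comp_continuous Complex.continuous_ofReal fun x => ?_
    simpa using ha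
  have hs1 : 0 < 1 - Real.exp (-(η / 2)) := by
    rw [sub_pos, Real.exp_lt_one_iff]; linarith
  have h := norm_integral_sub_interpolatory_le (g := fun t : ℝ => G ((R * t : ℝ) : ℂ)) hs
    (hcont.comp (by fun_prop)) (by positivity) (hc s.card) hW
  have hscale : (∫ x in (-R)..R, G x) = (R : ℂ) * ∫ t in (-1 : ℝ)..1, G ((R * t : ℝ) : ℂ) := by
    have := intervalIntegral.smul_integral_comp_mul_left (a := -1) (b := 1)
      (fun x : ℝ => G x) R
    simpa using this.symm
  rw [hscale, onInterval, Complex.real_smul, ← mul_sub, norm_mul, Complex.norm_real,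
    Real.norm_of_nonneg hR0.le]
  calc _ ≤ R * ((2 + W) * (M * Real.exp (-(η / 2)) ^ s.card * (8 / η))) := by
        refine mul_le_mul_of_nonneg_left (h.trans ?_) hR0.le
        gcongr _ * (_ * ?_)
        exact exp_half_geometric_le hη0 hη1
    _ = _ := by
        rw [← Real.exp_nat_mul, hη]
        have : -(a / (4 * R)) * s.card = s.card * -(a / (2 * R) / 2) := by
          field_simp; ring
        rw [this]
        field_simp
        ring

/-! ### Gauss–Legendre nodes and weights -/

section

open Polynomial

theorem natDegree_iterate_derivative_eq {K : Type*} [Field K] [CharZero K] (p : K[X]) (k : ℕ) :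
    (derivative^[k] p).natDegree = p.natDegree - k := by
  induction k with
  | zero => simp
  | succ k ih => rw [Function.iterate_succ_apply', natDegree_derivative, ih, Nat.sub_sub]

theorem natDegree_sq_sub_one_pow {K : Type*} [Field K] (n : ℕ) :
    ((X ^ 2 - 1 : K[X]) ^ n).natDegree = 2 * n := by
  rw [natDegree_pow, ← C_1, natDegree_X_pow_sub_C, mul_comm]

theorem iterate_derivative_sq_sub_one_pow_ne_zero {K : Type*} [Field K] [CharZero K] {n k : ℕ}
    (hk : k ≤ n) : derivative^[k] ((X ^ 2 - 1 : K[X]) ^ n) ≠ 0 := by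
  rcases Nat.eq_zero_or_pos n with rfl | hn
  · obtain rfl : k = 0 := by omega
    simp
  · apply ne_zero_of_natDegree_gt (n := 0)
    rw [natDegree_iterate_derivative_eq, natDegree_sq_sub_one_pow]
    omega

theorem isRoot_iterate_derivative_sq_sub_one_pow {n k : ℕ} (hk : k < n) {x : ℝ} (hx : x ^ 2 = 1) :
    (derivative^[k] ((X ^ 2 - 1 : ℝ[X]) ^ n)).IsRoot x := by
  have h1 : (X - C x) ^ n ∣ (X ^ 2 - 1 : ℝ[X]) ^ n := by
    apply pow_dvd_pow_of_dvd
    rw [dvd_iff_isRoot]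
    simp [hx]
  have h2 := pow_sub_dvd_iterate_derivative_of_pow_dvd k h1
  rw [← dvd_iff_isRoot]
  exact (dvd_pow_self _ (by omega)).trans h2

/-- Rolle's theorem with bookkeeping at the end points: `m` distinct roots produce at least `m - 1`
new roots of the derivative, and `±1`, being old roots, are not among them. While fewer than `n`
derivatives are taken, `±1` persist, so each derivative gains a root. -/
theorem card_roots_iterate_derivative_sq_sub_one_pow {n k : ℕ} (hk : k < n) :
    k + 2 ≤ (derivative^[k] ((X ^ 2 - 1 : ℝ[X]) ^ n)).roots.toFinset.card := by
  induction k with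
  | zero =>
    have : ({1, -1} : Finset ℝ) ⊆ (derivative^[0] ((X ^ 2 - 1 : ℝ[X]) ^ n)).roots.toFinset := by
      intro x hx
      rw [Multiset.mem_toFinset, mem_roots (iterate_derivative_sq_sub_one_pow_ne_zero (by omega))]
      apply isRoot_iterate_derivative_sq_sub_one_pow hk
      simp only [Finset.mem_insert, Finset.mem_singleton] at hx
      rcases hx with rfl | rfl <;> norm_num
    refine le_trans (le_of_eq ?_) (Finset.card_le_card this)
    rw [Finset.card_pair (by norm_num)]
  | succ k ih =>
    have h1 := ih (by omega)
    have h2 := card_roots_toFinset_le_card_roots_derivative_sdiff_roots_succ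
      (derivative^[k] ((X ^ 2 - 1 : ℝ[X]) ^ n))
    rw [← Function.iterate_succ_apply' (⇑derivative), Nat.succ_eq_add_one] at h2
    have h3 : ({1, -1} : Finset ℝ) ∪
        ((derivative^[k + 1] ((X ^ 2 - 1 : ℝ[X]) ^ n)).roots.toFinset \
          (derivative^[k] ((X ^ 2 - 1 : ℝ[X]) ^ n)).roots.toFinset) ⊆
        (derivative^[k + 1] ((X ^ 2 - 1 : ℝ[X]) ^ n)).roots.toFinset := by
      refine Finset.union_subset (fun x hx => ?_) Finset.sdiff_subset
      rw [Multiset.mem_toFinset, mem_roots (iterate_derivative_sq_sub_one_pow_ne_zero (by omega))]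
      apply isRoot_iterate_derivative_sq_sub_one_pow hk
      simp only [Finset.mem_insert, Finset.mem_singleton] at hx
      rcases hx with rfl | rfl <;> norm_num
    have h4 := Finset.card_le_card h3
    rw [Finset.card_union_of_disjoint, Finset.card_pair (by norm_num)] at h4
    · omega
    · rw [Finset.disjoint_left]
      intro x hx
      simp only [Finset.mem_sdiff, not_and_not_right]
      intro _
      rw [Multiset.mem_toFinset, mem_roots (iterate_derivative_sq_sub_one_pow_ne_zero (by omega))]
      apply isRoot_iterate_derivative_sq_sub_one_pow (by omega)
      simp only [Finset.mem_insert, Finset.mem_singleton] at hx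
      rcases hx with rfl | rfl <;> norm_num

theorem roots_legendre (n : ℕ) :
    (legendre n).roots = (derivative^[n] ((X ^ 2 - 1 : ℝ[X]) ^ n)).roots :=
  roots_C_mul _ (by positivity)

theorem legendre_ne_zero (n : ℕ) : legendre n ≠ 0 :=
  mul_ne_zero (C_ne_zero.2 (by positivity)) (iterate_derivative_sq_sub_one_pow_ne_zero (by omega))

theorem natDegree_legendre (n : ℕ) : (legendre n).natDegree = n := by
  rw [legendre, natDegree_C_mul (by positivity), natDegree_iterate_derivative_eq,
    natDegree_sq_sub_one_pow]
  omega

/-- The Legendre polynomial `P_n` has `n` distinct real roots. -/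
theorem card_roots_legendre (n : ℕ) : (legendre n).roots.toFinset.card = n := by
  apply le_antisymm
  · refine (Multiset.toFinset_card_le _).trans ((card_roots' _).trans_eq (natDegree_legendre n))
  · rcases n with _ | n
    · simp
    · rw [roots_legendre]
      have h1 := card_roots_iterate_derivative_sq_sub_one_pow (n := n + 1) (k := n) (by omega)
      have h2 := card_roots_toFinset_le_card_roots_derivative_sdiff_roots_succ
        (derivative^[n] ((X ^ 2 - 1 : ℝ[X]) ^ (n + 1)))
      rw [← Function.iterate_succ_apply' (⇑derivative), Nat.succ_eq_add_one] at h2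
      have h3 := Finset.card_le_card (Finset.sdiff_subset
        (s := (derivative^[n + 1] ((X ^ 2 - 1 : ℝ[X]) ^ (n + 1))).roots.toFinset)
        (t := (derivative^[n] ((X ^ 2 - 1 : ℝ[X]) ^ (n + 1))).roots.toFinset))
      omega

/-- Gauss–Lucas: the roots of a derivative lie in the convex hull of the roots, and the closed unit
disc is convex. Restricted to real roots, this places the Legendre nodes in `[-1, 1]`. -/
theorem norm_le_one_of_isRoot_iterate_derivative {n k : ℕ} (hk : k ≤ n) {z : ℂ}
    (hz : (derivative^[k] ((X ^ 2 - 1 : ℂ[X]) ^ n)).IsRoot z) : ‖z‖ ≤ 1 := by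
  induction k generalizing z with
  | zero =>
    have : z ^ 2 = 1 := by
      simp only [Function.iterate_zero, id, IsRoot.def, eval_pow, eval_sub, eval_X, eval_one] at hz
      exact sub_eq_zero.1 (eq_zero_of_pow_eq_zero hz)
    have h : ‖z‖ ^ 2 = 1 := by rw [← norm_pow, this, norm_one]
    nlinarith [norm_nonneg z]
  | succ k ih =>
    set P : ℂ[X] := derivative^[k] ((X ^ 2 - 1 : ℂ[X]) ^ n) with hP
    have hdeg : 0 < P.degree := by
      rw [← natDegree_pos_iff_degree_pos, natDegree_iterate_derivative_eq,
        natDegree_sq_sub_one_pow]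
      omega
    have h0 := iterate_derivative_sq_sub_one_pow_ne_zero (K := ℂ) hk
    rw [Function.iterate_succ_apply', ← hP] at hz h0
    have hz' : z ∈ P.derivative.rootSet ℂ := by
      rw [mem_rootSet, coe_aeval_eq_eval]
      exact ⟨h0, hz⟩
    have hsub : P.rootSet ℂ ⊆ Metric.closedBall 0 1 := by
      intro w hw
      rw [mem_rootSet, coe_aeval_eq_eval] at hw
      rw [mem_closedBall_zero_iff]
      exact ih (by omega) hw.2
    have := convexHull_min hsub (convex_closedBall 0 1)
      (rootSet_derivative_subset_convexHull_rootSet hdeg hz')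
    rwa [mem_closedBall_zero_iff] at this

theorem legendre_roots_mem_Icc {n : ℕ} {x : ℝ} (hx : x ∈ (legendre n).roots.toFinset) :
    x ∈ Set.Icc (-1 : ℝ) 1 := by
  rw [roots_legendre, Multiset.mem_toFinset,
    mem_roots (iterate_derivative_sq_sub_one_pow_ne_zero (by omega))] at hx
  have h := norm_le_one_of_isRoot_iterate_derivative (n := n) (k := n) le_rfl (z := (x : ℂ)) ?_
  · rw [Complex.norm_real, Real.norm_eq_abs, abs_le] at h
    exact h
  · have := hx.map (f := Complex.ofRealHom)
    rw [← iterate_derivative_map] at this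
    simpa using this

/-- Repeated integration by parts; the boundary terms vanish because every derivative of `(x² -
1)^n` of order below `n` is zero at `±1`. -/
theorem integral_iterate_derivative_mul (n k : ℕ) (hk : k ≤ n) (q : ℝ[X]) :
    ∫ t in (-1 : ℝ)..1, (derivative^[n] ((X ^ 2 - 1 : ℝ[X]) ^ n)).eval t * q.eval t =
      (-1) ^ k * ∫ t in (-1 : ℝ)..1,
        (derivative^[n - k] ((X ^ 2 - 1 : ℝ[X]) ^ n)).eval t * (derivative^[k] q).eval t := by
  induction k with
  | zero => simp
  | succ k ih =>
    rw [ih (by omega)]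
    have e : n - k = (n - (k + 1)) + 1 := by omega
    have h := intervalIntegral.integral_mul_deriv_eq_deriv_mul (a := (-1 : ℝ)) (b := 1)
      (u := fun t => (derivative^[k] q).eval t) (u' := fun t => (derivative^[k + 1] q).eval t)
      (v := fun t => (derivative^[n - (k + 1)] ((X ^ 2 - 1 : ℝ[X]) ^ n)).eval t)
      (v' := fun t => (derivative^[n - k] ((X ^ 2 - 1 : ℝ[X]) ^ n)).eval t)
      (fun x _ => by rw [Function.iterate_succ_apply']; exact Polynomial.hasDerivAt _ x)
      (fun x _ => by rw [e, Function.iterate_succ_apply']; exact Polynomial.hasDerivAt _ x)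
      (by apply Continuous.intervalIntegrable; fun_prop)
      (by apply Continuous.intervalIntegrable; fun_prop)
    have r1 := isRoot_iterate_derivative_sq_sub_one_pow (n := n) (k := n - (k + 1)) (x := 1)
      (by omega) (by norm_num)
    have r2 := isRoot_iterate_derivative_sq_sub_one_pow (n := n) (k := n - (k + 1)) (x := -1)
      (by omega) (by norm_num)
    rw [IsRoot.def] at r1 r2
    rw [r1, r2] at h
    simp only [mul_zero, sub_zero, zero_sub] at h
    simp_rw [mul_comm ((derivative^[n - k] ((X ^ 2 - 1 : ℝ[X]) ^ n)).eval _)]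
    rw [h, pow_succ]
    simp_rw [mul_comm ((derivative^[k + 1] q).eval _)]
    ring

/-- The Legendre polynomial `P_n` is orthogonal to all polynomials of degree less than `n`. -/
theorem integral_legendre_mul {n : ℕ} {q : ℝ[X]} (hq : q.degree < n) :
    ∫ t in (-1 : ℝ)..1, (legendre n * q).eval t = 0 := by
  have h := integral_iterate_derivative_mul n n le_rfl q
  rw [iterate_derivative_eq_zero_of_degree_lt hq] at h
  simp only [legendre, eval_mul, eval_C, mul_assoc]
  rw [intervalIntegral.integral_const_mul, h]
  simp

/-- The weights of Gauss-Legendre quadrature are positive and add up to `2`. -/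
theorem sum_abs_weights_gaussLegendre {n : ℕ} (hn : n ≠ 0) :
    ∑ x ∈ (legendre n).roots.toFinset,
      |∫ t in (-1 : ℝ)..1, (Lagrange.basis (legendre n).roots.toFinset id x).eval t| = 2 := by
  set s := (legendre n).roots.toFinset with hs
  have hcard : s.card = n := card_roots_legendre n
  have hinj : Set.InjOn (id : ℝ → ℝ) s := Function.injective_id.injOn
  have hpos : ∀ x ∈ s, 0 ≤ ∫ t in (-1 : ℝ)..1, (Lagrange.basis s id x).eval t := by
    intro x hx
    set l := Lagrange.basis s id x with hl
    have hdeg : l.natDegree = n - 1 := by rw [hl, Lagrange.natDegree_basis hinj hx, hcard]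
    -- `l² - l` vanishes at all `n` nodes, hence so does its remainder modulo `P_n`, which has
    -- degree below `n`. The quotient has degree below `n`, so orthogonality gives `∫ l = ∫ l² ≥ 0`.
    have hdvd : legendre n ∣ l * l - l := by
      rw [← EuclideanDomain.mod_eq_zero]
      refine eq_zero_of_degree_lt_of_eval_finset_eq_zero s ?_ fun y hy => ?_
      · refine (EuclideanDomain.mod_lt _ (legendre_ne_zero n)).trans_eq ?_
        rw [degree_eq_natDegree (legendre_ne_zero n), natDegree_legendre, hcard]
      · have hy0 : (legendre n).eval y = 0 :=
          (mem_roots (legendre_ne_zero n)).1 (Multiset.mem_toFinset.1 hy)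
        have h := congrArg (eval y) (EuclideanDomain.div_add_mod (l * l - l) (legendre n))
        rw [eval_add, eval_mul, hy0, zero_mul, zero_add] at h
        rw [h, eval_sub, eval_mul]
        rcases eq_or_ne x y with rfl | hxy
        · have : eval x l = 1 := Lagrange.eval_basis_self hinj hx
          rw [this]; norm_num
        · have : eval y l = 0 := Lagrange.eval_basis_of_ne (v := id) hxy hy
          rw [this]; norm_num
    obtain ⟨q, hq⟩ := hdvd
    have hqd : q.degree < n := by
      rcases eq_or_ne q 0 with rfl | hq0
      · simp
      have h1 : (l * l - l).natDegree ≤ 2 * (n - 1) := by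
        refine (natDegree_sub_le _ _).trans (max_le ?_ (by omega))
        exact natDegree_mul_le.trans (by omega)
      rw [hq, natDegree_mul (legendre_ne_zero n) hq0, natDegree_legendre] at h1
      exact (natDegree_lt_iff_degree_lt hq0).1 (by omega)
    have h0 := integral_legendre_mul hqd
    rw [← hq] at h0
    simp only [eval_sub, eval_mul] at h0
    rw [intervalIntegral.integral_sub (by apply Continuous.intervalIntegrable; fun_prop)
      (by apply Continuous.intervalIntegrable; fun_prop), sub_eq_zero] at h0
    rw [← h0]
    exact intervalIntegral.integral_nonneg (by norm_num) fun t _ => mul_self_nonneg _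
  rw [Finset.sum_congr rfl fun x hx => abs_of_nonneg (hpos x hx),
    ← intervalIntegral.integral_finsetSum fun i _ => by
      apply Continuous.intervalIntegrable; fun_prop]
  simp_rw [← eval_finsetSum]
  rw [Lagrange.sum_basis hinj (by rw [← Finset.card_pos]; omega)]
  norm_num

end

/-! ### Clenshaw–Curtis nodes and weights -/

section

open Polynomial Polynomial.Chebyshev

/-- The Dirichlet kernel with both end terms halved. It vanishes at `γ = mπ/N` unless `γ` is a
multiple of `2π`, which is the discrete orthogonality of cosines at the Chebyshev points. -/
theorem two_sin_half_mul_sum_cos (N : ℕ) (γ : ℝ) :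
    2 * Real.sin (γ / 2) * (∑ k ∈ Finset.range N, Real.cos (k * γ) + (Real.cos (N * γ) - 1) / 2) =
      Real.sin (N * γ) * Real.cos (γ / 2) := by
  induction N with
  | zero => simp
  | succ N ih =>
    rw [Finset.sum_range_succ]
    have h1 : Real.cos γ = 1 - 2 * Real.sin (γ / 2) ^ 2 := by
      have := Real.cos_two_mul (γ / 2)
      rw [mul_div_cancel₀ _ two_ne_zero] at this
      rw [this, Real.sin_sq]; ring
    have h2 : Real.sin γ = 2 * Real.sin (γ / 2) * Real.cos (γ / 2) := by
      rw [← Real.sin_two_mul]; ring_nf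
    push_cast
    rw [add_mul, one_mul, Real.cos_add, Real.sin_add]
    have h3 := Real.sin_sq_add_cos_sq (γ / 2)
    rw [h1, h2]
    linear_combination ih - 2 * Real.sin (γ / 2) * Real.cos (N * γ) * h3

/-- The trigonometric sum which is, up to normalization, the Lagrange basis polynomial of the node
`cos θ` among the Chebyshev points. -/
noncomputable def chebyshevKernel (N : ℕ) (θ : ℝ) : ℝ[X] :=
  ∑ k ∈ Finset.range N, C (Real.cos (k * θ)) * T ℝ k + C (Real.cos (N * θ) / 2) * T ℝ N - C (1 / 2)

theorem eval_chebyshevKernel (N : ℕ) (θ φ : ℝ) : (chebyshevKernel N θ).eval (Real.cos φ) =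
    ∑ k ∈ Finset.range N, Real.cos (k * θ) * Real.cos (k * φ) +
      (Real.cos (N * θ) * Real.cos (N * φ) - 1) / 2 := by
  simp only [chebyshevKernel, eval_sub, eval_add, eval_finsetSum, eval_mul, eval_C, T_real_cos,
    Int.cast_natCast]
  ring

theorem degree_chebyshevKernel_lt (N : ℕ) (θ : ℝ) : (chebyshevKernel N θ).degree < (N + 1 : ℕ) := by
  have hT : ∀ (k : ℕ) (c : ℝ), k ≤ N → (C c * T ℝ k).degree < (N + 1 : ℕ) := by
    intro k c hk
    rw [C_mul']
    refine (degree_smul_le _ _).trans_lt ?_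
    rw [degree_T, Nat.cast_lt]
    omega
  refine (degree_sub_le _ _).trans_lt (max_lt ((degree_add_le _ _).trans_lt (max_lt ?_ ?_)) ?_)
  · refine (degree_sum_le _ _).trans_lt ((Finset.sup_lt_iff (WithBot.bot_lt_coe _)).2 fun k hk => ?_)
    exact hT k _ (Finset.mem_range.1 hk).le
  · exact hT N _ le_rfl
  · exact degree_C_le.trans_lt (by exact_mod_cast Nat.succ_pos N)

theorem abs_eval_chebyshevKernel_le (N : ℕ) (θ : ℝ) {t : ℝ} (ht : t ∈ Set.Icc (-1 : ℝ) 1) :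
    |(chebyshevKernel N θ).eval t| ≤ N + 1 := by
  rw [← Real.cos_arccos ht.1 ht.2, eval_chebyshevKernel]
  have hc : ∀ x y : ℝ, |Real.cos x * Real.cos y| ≤ 1 := fun x y => by
    rw [abs_mul]
    exact mul_le_one₀ (Real.abs_cos_le_one _) (abs_nonneg _) (Real.abs_cos_le_one _)
  refine (abs_add_le _ _).trans (add_le_add ?_ ?_)
  · refine (Finset.abs_sum_le_sum_abs _ _).trans ((Finset.sum_le_sum fun k _ => hc _ _).trans ?_)
    simp
  · have := abs_le.1 (hc (N * θ) (N * Real.arccos t))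
    rw [abs_le]
    constructor <;> linarith

/-- The product formula for cosines splits the value into halved-end cosine sums at `(i ± j)π/N`.
Both `i + j` and `i - j` are nonzero and smaller than `2N` in absolute value, so both sums vanish.
-/
theorem eval_chebyshevKernel_eq_zero {N i j : ℕ} (hi : i ≤ N) (hj : j ≤ N) (hij : i ≠ j) :
    (chebyshevKernel N (i * Real.pi / N)).eval (Real.cos (j * Real.pi / N)) = 0 := by
  have hN : 0 < N := by omega
  have hN' : (0 : ℝ) < N := by exact_mod_cast hN
  have hN0 : (N : ℝ) ≠ 0 := hN'.ne'
  have key : ∀ m : ℤ, m ≠ 0 → |m| < 2 * N →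
      ∑ k ∈ Finset.range N, Real.cos (k * (m * Real.pi / N)) +
        (Real.cos (N * (m * Real.pi / N)) - 1) / 2 = 0 := by
    intro m hm hmN
    have h := two_sin_half_mul_sum_cos N (m * Real.pi / N)
    rw [mul_div_cancel₀ _ hN0, Real.sin_int_mul_pi, zero_mul] at h
    rw [mul_div_cancel₀ _ hN0]
    refine (mul_eq_zero.1 h).resolve_left (mul_ne_zero two_ne_zero ?_)
    rw [Ne, Real.sin_eq_zero_iff]
    rintro ⟨l, hl⟩
    field_simp at hl
    have hl' : 2 * N * l = m := by exact_mod_cast (by linarith : (2 * N * l : ℝ) = m)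
    have hl0 : l ≠ 0 := by rintro rfl; simp at hl'; exact hm hl'.symm
    have : 1 ≤ |l| := Int.one_le_abs hl0
    rw [← hl', abs_mul, abs_of_nonneg (by positivity)] at hmN
    nlinarith
  have k1 := key (i + j) (by omega) (by rw [abs_lt]; omega)
  have k2 := key (i - j) (by omega) (by rw [abs_lt]; omega)
  rw [eval_chebyshevKernel]
  have hp : ∀ x : ℝ, Real.cos (x * (i * Real.pi / N)) * Real.cos (x * (j * Real.pi / N)) =
      (Real.cos (x * (((i + j : ℤ) : ℝ) * Real.pi / N)) +
        Real.cos (x * (((i - j : ℤ) : ℝ) * Real.pi / N))) / 2 := by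
    intro x
    push_cast
    rw [show x * ((i + j) * Real.pi / N) = x * (i * Real.pi / N) + x * (j * Real.pi / N) by ring,
      show x * ((i - j) * Real.pi / N) = x * (i * Real.pi / N) - x * (j * Real.pi / N) by ring,
      Real.cos_add, Real.cos_sub]
    ring
  simp_rw [hp]
  rw [← Finset.sum_div, Finset.sum_add_distrib]
  linarith

/-- At a node `cos²(Nθ) = 1` removes the end correction, leaving a sum of squares whose `k = 0` term
is `1`. -/
theorem one_le_eval_chebyshevKernel_self {N i : ℕ} (hN : 0 < N) :
    1 ≤ (chebyshevKernel N (i * Real.pi / N)).eval (Real.cos (i * Real.pi / N)) := by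
  have hN0 : (N : ℝ) ≠ 0 := by positivity
  have h1 : Real.cos (N * (i * Real.pi / N)) * Real.cos (N * (i * Real.pi / N)) = 1 := by
    rw [mul_div_cancel₀ _ hN0]
    have := Real.sin_sq_add_cos_sq (i * Real.pi)
    rw [Real.sin_nat_mul_pi] at this
    nlinarith
  rw [eval_chebyshevKernel, h1, sub_self, zero_div, add_zero]
  refine le_trans (le_of_eq ?_) (Finset.single_le_sum (fun k _ => mul_self_nonneg _)
    (Finset.mem_range.2 hN))
  simp

theorem chebyshevPoints_succ (N : ℕ) : chebyshevPoints (N + 1) =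
    (Finset.range (N + 1)).image fun j : ℕ => Real.cos (j * Real.pi / N) := by
  simp [chebyshevPoints]

theorem card_chebyshevPoints {n : ℕ} (hn : 2 ≤ n) : (chebyshevPoints n).card = n := by
  obtain ⟨N, rfl⟩ : ∃ N, n = N + 1 := ⟨n - 1, by omega⟩
  have hN : 0 < N := by omega
  rw [chebyshevPoints_succ, Finset.card_image_of_injOn, Finset.card_range]
  intro i hi j hj hij
  by_contra hne
  simp only [Finset.coe_range, Set.mem_Iio] at hi hj hij
  -- The kernel of node `i` separates the nodes: it is at least `1` at its own node and zero at the
  -- others.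
  have h := eval_chebyshevKernel_eq_zero (N := N) (by omega : i ≤ N) (by omega : j ≤ N) hne
  rw [← hij] at h
  linarith [one_le_eval_chebyshevKernel_self (i := i) hN]

theorem chebyshevPoints_mem_Icc {n : ℕ} {x : ℝ} (hx : x ∈ chebyshevPoints n) :
    x ∈ Set.Icc (-1 : ℝ) 1 := by
  obtain ⟨j, -, rfl⟩ := Finset.mem_image.1 hx
  exact Real.cos_mem_Icc _

/-- Each Lagrange basis polynomial is a kernel divided by its value `A ≥ 1` at its own node, hence
at most `n` in absolute value on `[-1, 1]`; so each of the `n` weights is at most `2n`. Any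
polynomial bound would do. -/
theorem sum_abs_weights_clenshawCurtis_le {n : ℕ} (hn : 2 ≤ n) :
    ∑ x ∈ chebyshevPoints n,
      |∫ t in (-1 : ℝ)..1, (Lagrange.basis (chebyshevPoints n) id x).eval t| ≤ 2 * (n : ℝ) ^ 2 := by
  have hcard := card_chebyshevPoints hn
  obtain ⟨N, rfl⟩ : ∃ N, n = N + 1 := ⟨n - 1, by omega⟩
  have hN : 0 < N := by omega
  set s := chebyshevPoints (N + 1) with hs
  have hinj : Set.InjOn (id : ℝ → ℝ) s := Function.injective_id.injOn
  have hw : ∀ x ∈ s, |∫ t in (-1 : ℝ)..1, (Lagrange.basis s id x).eval t| ≤ 2 * (N + 1 : ℝ) := by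
    intro x hx
    have hx' := hx
    rw [hs, chebyshevPoints_succ] at hx'
    obtain ⟨i, hi, rfl⟩ := Finset.mem_image.1 hx'
    rw [Finset.mem_range] at hi
    set θ := (i * Real.pi / N : ℝ)
    have h1 := one_le_eval_chebyshevKernel_self (i := i) hN
    set A := (chebyshevKernel N θ).eval (Real.cos θ) with hA
    have hbasis : Lagrange.basis s id (Real.cos θ) = C A⁻¹ * chebyshevKernel N θ := by
      apply eq_of_degrees_lt_of_eval_finset_eq s
      · rw [Lagrange.degree_basis hinj hx, Nat.cast_lt]
        omega
      · rw [hcard]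
        rw [C_mul']
        exact (degree_smul_le _ _).trans_lt (degree_chebyshevKernel_lt N θ)
      · intro y hy
        rw [eval_mul, eval_C]
        rcases eq_or_ne (Real.cos θ) y with rfl | hxy
        · rw [← hA, inv_mul_cancel₀ (by linarith)]
          have h1 : eval (Real.cos θ) (Lagrange.basis s id (Real.cos θ)) = 1 :=
            Lagrange.eval_basis_self (v := id) hinj hx
          exact h1
        · have h0 : eval y (Lagrange.basis s id (Real.cos θ)) = 0 :=
            Lagrange.eval_basis_of_ne (v := id) hxy hy
          rw [h0]
          rw [hs, chebyshevPoints_succ] at hy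
          obtain ⟨j, hj, rfl⟩ := Finset.mem_image.1 hy
          rw [Finset.mem_range] at hj
          rw [eval_chebyshevKernel_eq_zero (by omega) (by omega) (fun h => hxy (by rw [← h])),
            mul_zero]
    rw [← Real.norm_eq_abs]
    refine (intervalIntegral.norm_integral_le_of_norm_le_const (C := (N + 1 : ℝ))
      fun t ht => ?_).trans_eq (by norm_num [mul_comm])
    rw [Set.uIoc_of_le (by norm_num)] at ht
    rw [hbasis, eval_mul, eval_C, norm_mul, Real.norm_eq_abs, Real.norm_eq_abs, abs_inv]
    refine (mul_le_of_le_one_left (abs_nonneg _) ?_).trans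
      (abs_eval_chebyshevKernel_le N θ ⟨ht.1.le, ht.2⟩)
    exact inv_le_one_of_one_le₀ (h1.trans (le_abs_self _))
  refine (Finset.sum_le_sum hw).trans_eq ?_
  rw [Finset.sum_const, hcard, nsmul_eq_mul]
  push_cast
  ring

end

/-! ### The trapezoidal rule by Poisson summation -/

section

open scoped FourierTransform Topology

/-- Cauchy's theorem on `[-T, T] × [0, σ]`; the vertical sides are bounded by `|σ| m(±T)`, which
tends to zero. -/
theorem integral_eq_integral_shift {f : ℂ → ℂ} {m : ℝ → ℝ} {β σ : ℝ}
    (hf : DifferentiableOn ℂ f {z : ℂ | |z.im| ≤ β}) (hσ : |σ| ≤ β)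
    (hm : ∀ z : ℂ, |z.im| ≤ β → ‖f z‖ ≤ m z.re) (hmi : Integrable m)
    (hm0 : Tendsto m (cocompact ℝ) (𝓝 0)) :
    ∫ x : ℝ, f x = ∫ x : ℝ, f (x + σ * Complex.I) := by
  have hline : ∀ τ : ℝ, |τ| ≤ β → Continuous fun x : ℝ => f (x + τ * Complex.I) := fun τ hτ =>
    hf.continuousOn.comp_continuous (by fun_prop) fun x => by simpa using hτ
  have hint : ∀ τ : ℝ, |τ| ≤ β → Integrable fun x : ℝ => f (x + τ * Complex.I) := fun τ hτ =>
    hmi.mono' (hline τ hτ).aestronglyMeasurable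
      (Eventually.of_forall fun x => by simpa using hm (x + τ * Complex.I) (by simpa using hτ))
  have h0 : |(0 : ℝ)| ≤ β := by simpa using (abs_nonneg σ).trans hσ
  have hi0 : Integrable fun x : ℝ => f x := by simpa using hint 0 h0
  have t1 := intervalIntegral_tendsto_integral hi0 tendsto_neg_atTop_atBot tendsto_id
  have t2 := intervalIntegral_tendsto_integral (hint σ hσ) tendsto_neg_atTop_atBot tendsto_id
  have hin : ∀ y ∈ Set.uIcc 0 σ, |y| ≤ β := fun y hy => by
    have := Set.abs_sub_le_of_uIcc_subset_uIcc (Set.uIcc_subset_uIcc hy Set.left_mem_uIcc)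
    simp only [zero_sub, abs_neg, sub_zero] at this
    exact this.trans hσ
  have hv : ∀ u : ℝ → ℝ, Tendsto u atTop (cocompact ℝ) →
      Tendsto (fun T => ∫ y in (0 : ℝ)..σ, f (u T + y * Complex.I)) atTop (𝓝 0) := by
    intro u hu
    refine squeeze_zero_norm (a := fun T => m (u T) * |σ - 0|) (fun T => ?_)
      (by simpa [Function.comp_def] using (hm0.comp hu).mul_const |σ - 0|)
    refine intervalIntegral.norm_integral_le_of_norm_le_const (C := m (u T)) fun y hy => ?_
    simpa using hm (u T + y * Complex.I) (by simpa using hin y (Set.uIoc_subset_uIcc hy))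
  have t3 := hv id (by rw [cocompact_eq_atBot_atTop]; exact tendsto_id.mono_right le_sup_right)
  have t4 := hv (fun T => -T) (by
    rw [cocompact_eq_atBot_atTop]; exact tendsto_neg_atTop_atBot.mono_right le_sup_left)
  have hlim := ((t1.sub t2).add (t3.const_mul Complex.I)).sub (t4.const_mul Complex.I)
  have hzero : ∀ T : ℝ, (((∫ x in (-T)..T, f x) - ∫ x in (-T)..T, f (x + σ * Complex.I)) +
      Complex.I * ∫ y in (0 : ℝ)..σ, f (T + y * Complex.I)) -
      Complex.I * ∫ y in (0 : ℝ)..σ, f ((-T : ℝ) + y * Complex.I) = 0 := by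
    intro T
    have h := Complex.integral_boundary_rect_eq_zero_of_differentiableOn f ((-T : ℝ) : ℂ)
      ((T : ℂ) + σ * Complex.I) (hf.mono ?_)
    · simpa using h
    · rintro w ⟨-, hw⟩
      exact hin _ (by simpa using hw)
  simp only [id] at hlim
  simp only [hzero, mul_zero, add_zero, sub_zero] at hlim
  exact (sub_eq_zero.1 (tendsto_nhds_unique hlim tendsto_const_nhds))

theorem norm_fourier_le {f : ℂ → ℂ} {m : ℝ → ℝ} {β : ℝ} (hβ : 0 ≤ β)
    (hf : DifferentiableOn ℂ f {z : ℂ | |z.im| ≤ β})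
    (hm : ∀ z : ℂ, |z.im| ≤ β → ‖f z‖ ≤ m z.re) (hmi : Integrable m)
    (hm0 : Tendsto m (cocompact ℝ) (𝓝 0)) (k : ℤ) :
    ‖𝓕 (fun x : ℝ => f x) (k : ℝ)‖ ≤
      (∫ x, m x) * Real.exp (-(Real.pi * β)) ^ (2 * k.natAbs) := by
  obtain ⟨σ, hσ, hσk⟩ : ∃ σ : ℝ, |σ| ≤ β ∧ k * σ = -(β * k.natAbs) := by
    rcases le_total 0 k with h | h
    · refine ⟨-β, by rw [abs_neg, abs_of_nonneg hβ], ?_⟩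
      rw [Nat.cast_natAbs, abs_of_nonneg h]; ring
    · refine ⟨β, by rw [abs_of_nonneg hβ], ?_⟩
      rw [Nat.cast_natAbs, abs_of_nonpos h]; push_cast; ring
  have hn : ∀ z : ℂ, ‖Complex.exp (-(2 * Real.pi * k * Complex.I * z)) * f z‖ =
      ‖f z‖ * Real.exp (2 * Real.pi * (k * z.im)) := by
    intro z
    rw [norm_mul, Complex.norm_exp, mul_comm]
    congr 2
    simp [mul_assoc]
  have h := integral_eq_integral_shift (σ := σ)
    (f := fun z => Complex.exp (-(2 * Real.pi * k * Complex.I * z)) * f z)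
    (m := fun x => m x * Real.exp (2 * Real.pi * (|(k : ℝ)| * β)))
    (DifferentiableOn.mul (by fun_prop) hf) hσ (fun z hz => by
      rw [hn]
      refine mul_le_mul (hm z hz) (Real.exp_le_exp.2 ?_) (Real.exp_nonneg _)
        ((norm_nonneg _).trans (hm z hz))
      gcongr 2 * Real.pi * ?_
      exact (le_abs_self _).trans (by rw [abs_mul]; gcongr))
    (hmi.mul_const _) (by simpa using hm0.mul_const (Real.exp (2 * Real.pi * (|(k : ℝ)| * β))))
  have e : 𝓕 (fun x : ℝ => f x) (k : ℝ) =
      ∫ x : ℝ, Complex.exp (-(2 * Real.pi * k * Complex.I * x)) * f x := by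
    rw [Real.fourier_real_eq_integral_exp_smul]
    congr 1
    funext x
    rw [smul_eq_mul]
    congr 2
    push_cast
    ring
  rw [e, h, ← Real.exp_nat_mul, ← integral_mul_const]
  refine norm_integral_le_of_norm_le (hmi.mul_const _) (Eventually.of_forall fun x => ?_)
  rw [hn]
  have h1 : (x + σ * Complex.I : ℂ).im = σ := by simp
  have h2 : (x + σ * Complex.I : ℂ).re = x := by simp
  have h3 := hm (x + σ * Complex.I) (by rw [h1]; exact hσ)
  rw [h2] at h3
  rw [h1, hσk]
  refine mul_le_mul h3 (le_of_eq ?_) (Real.exp_nonneg _) ((norm_nonneg _).trans h3)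
  congr 1
  push_cast
  ring

theorem tendsto_exp_neg_mul_sq_cocompact {b : ℝ} (hb : 0 < b) :
    Tendsto (fun x : ℝ => Real.exp (-b * x ^ 2)) (cocompact ℝ) (𝓝 0) := by
  refine Real.tendsto_exp_atBot.comp ?_
  have h : Tendsto (fun x : ℝ => x ^ 2) (cocompact ℝ) atTop := by
    simpa [Function.comp_def] using
      (tendsto_pow_atTop (α := ℝ) two_ne_zero).comp (tendsto_norm_cocompact_atTop (E := ℝ))
  exact h.const_mul_atTop_of_neg (by linarith)

/-- Polynomial decay of an order above `1` is the form in which Poisson summation asks for it. -/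
theorem isBigO_exp_neg_mul_sq_cocompact {b : ℝ} (hb : 0 < b) :
    (fun x : ℝ => Real.exp (-b * x ^ 2)) =O[cocompact ℝ] fun x => |x| ^ (-2 : ℝ) := by
  refine IsBigO.of_bound b⁻¹ ?_
  filter_upwards [(Set.finite_singleton (0 : ℝ)).isCompact.compl_mem_cocompact] with x hx
  have hx0 : x ≠ 0 := hx
  have hx2 : 0 < x ^ 2 := by positivity
  rw [Real.norm_of_nonneg (Real.exp_nonneg _), Real.norm_of_nonneg (by positivity),
    Real.rpow_neg (abs_nonneg _), Real.rpow_two, sq_abs, ← mul_inv, neg_mul, Real.exp_neg]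
  refine inv_anti₀ (by positivity) ?_
  linarith [Real.add_one_le_exp (b * x ^ 2)]

/-- The trapezoidal rule with step `h` on the whole line converges exponentially in `1 / h`. -/
theorem norm_tsum_sub_integral_le {G : ℂ → ℂ} {A β h : ℝ} (hβ : 0 < β) (hh : 0 < h)
    (hG : DifferentiableOn ℂ G {z : ℂ | |z.im| ≤ β})
    (hGA : ∀ z : ℂ, |z.im| ≤ β → ‖G z‖ ≤ A * Real.exp (-z.re ^ 2 / 2)) (x₀ : ℝ) :
    ‖h * ∑' k : ℤ, G ((x₀ + h * k : ℝ) : ℂ) - ∫ x : ℝ, G x‖ ≤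
      A * √(2 * Real.pi) * Real.exp (-(Real.pi * (β / h))) *
        (2 / (1 - Real.exp (-(Real.pi * (β / h))))) := by
  have hA : 0 ≤ A := by
    have := (norm_nonneg _).trans (hGA 0 (by simpa using hβ.le))
    simpa using this
  -- Rescaling makes the nodes a translate of `ℤ` and widens the strip to half-width `β / h`, hence
  -- the rate.
  set f : ℂ → ℂ := fun z => G (h * z) with hfdef
  set b : ℝ := h ^ 2 / 2 with hb
  have hb0 : 0 < b := by positivity
  set m : ℝ → ℝ := fun x => A * Real.exp (-b * x ^ 2) with hmdef
  have hmem : ∀ z : ℂ, |z.im| ≤ β / h → |(h * z).im| ≤ β := by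
    intro z hz
    rw [Complex.im_ofReal_mul, abs_mul, abs_of_pos hh]
    rwa [le_div_iff₀' hh] at hz
  have hf : DifferentiableOn ℂ f {z : ℂ | |z.im| ≤ β / h} :=
    hG.comp (by fun_prop) fun z hz => hmem z hz
  have hm : ∀ z : ℂ, |z.im| ≤ β / h → ‖f z‖ ≤ m z.re := by
    intro z hz
    refine (hGA _ (hmem z hz)).trans_eq ?_
    rw [Complex.re_ofReal_mul, hmdef, hb]
    ring_nf
  have hmi : Integrable m := (integrable_exp_neg_mul_sq hb0).const_mul A
  have hm0 : Tendsto m (cocompact ℝ) (𝓝 0) := by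
    have := (tendsto_exp_neg_mul_sq_cocompact hb0).const_mul A
    rwa [mul_zero] at this
  have hmint : ∫ x, m x = A * √(2 * Real.pi) / h := by
    rw [hmdef, integral_const_mul, integral_gaussian, hb,
      show Real.pi / (h ^ 2 / 2) = 2 * Real.pi / h ^ 2 by field_simp, Real.sqrt_div (by positivity),
      Real.sqrt_sq hh.le, mul_div_assoc]
  have hcont : Continuous fun x : ℝ => f x :=
    hf.continuousOn.comp_continuous Complex.continuous_ofReal fun x => by
      simpa using (div_pos hβ hh).le
  have hbig : (fun x : ℝ => f x) =O[cocompact ℝ] fun x => |x| ^ (-2 : ℝ) := by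
    refine IsBigO.trans ?_ (isBigO_exp_neg_mul_sq_cocompact hb0)
    refine IsBigO.of_bound A (Eventually.of_forall fun x => ?_)
    rw [Real.norm_of_nonneg (Real.exp_nonneg _)]
    exact hm x (by simpa using (div_pos hβ hh).le)
  set s := Real.exp (-(Real.pi * (β / h))) with hs
  have hs0 : 0 ≤ s := Real.exp_nonneg _
  have hs1 : s < 1 := by
    rw [hs, Real.exp_lt_one_iff]
    have := Real.pi_pos
    have : 0 < Real.pi * (β / h) := by positivity
    linarith
  have hF : ∀ k : ℤ, ‖𝓕 (fun x : ℝ => f x) (k : ℝ)‖ ≤ A * √(2 * Real.pi) / h * s ^ (2 * k.natAbs) := by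
    intro k
    rw [← hmint]
    exact norm_fourier_le (div_pos hβ hh).le hf hm hmi hm0 k
  have hpois := Real.tsum_eq_tsum_fourier_of_rpow_decay_of_summable hcont one_lt_two hbig
    (summable_of_norm_le_geometric hs0 hs1 hF) (x₀ / h)
  set c : ℤ → ℂ := fun k => 𝓕 (fun x : ℝ => f x) (k : ℝ) * fourier k ((x₀ / h : ℝ) : UnitAddCircle)
    with hc
  have hck : ∀ k, ‖c k‖ ≤ A * √(2 * Real.pi) / h * s ^ (2 * k.natAbs) := by
    intro k
    rw [hc, norm_mul, fourier_apply, Circle.norm_coe, mul_one]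
    exact hF k
  -- The window for `n = 1` is `{0}`: the zero frequency is the integral, and the rest is the error.
  have hbound := norm_tsum_sub_sum_le hs0 hs1 (by positivity) hck 1
  have hc0 : ∑ k ∈ Finset.Ioo (-((1 : ℕ) : ℤ)) (1 : ℕ), c k = (h : ℂ)⁻¹ * ∫ x : ℝ, G x := by
    have : Finset.Ioo (-((1 : ℕ) : ℤ)) (1 : ℕ) = {0} := by decide
    rw [this, Finset.sum_singleton, hc]
    simp only [Int.cast_zero, fourier_zero, mul_one]
    rw [Real.fourier_real_eq_integral_exp_smul]
    have e := Measure.integral_comp_mul_left (fun x : ℝ => G x) h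
    rw [abs_of_pos (inv_pos.2 hh), Complex.real_smul, Complex.ofReal_inv] at e
    rw [← e]
    simp [hfdef]
  have hsum : ∑' k : ℤ, f ((x₀ / h + k : ℝ) : ℂ) = ∑' k : ℤ, G ((x₀ + h * k : ℝ) : ℂ) := by
    refine tsum_congr fun k => ?_
    simp only [hfdef]
    congr 1
    push_cast
    have : (h : ℂ) ≠ 0 := by exact_mod_cast hh.ne'
    field_simp
  rw [← hpois, hsum, hc0] at hbound
  have hhc : (h : ℂ) ≠ 0 := by exact_mod_cast hh.ne'
  calc _ = h * ‖∑' k : ℤ, G ((x₀ + h * k : ℝ) : ℂ) - (h : ℂ)⁻¹ * ∫ x : ℝ, G x‖ := by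
        have hn : h = ‖(h : ℂ)‖ := by rw [Complex.norm_real, Real.norm_of_nonneg hh.le]
        conv_rhs => rw [hn, ← norm_mul, ← hn, mul_sub, mul_inv_cancel_left₀ hhc]
    _ ≤ h * (A * √(2 * Real.pi) / h * s ^ 1 * (2 / (1 - s))) := by gcongr
    _ = _ := by field_simp

/-- The part of the trapezoidal sum on the line which the trapezoidal rule on `[-R, R]` omits. -/
theorem norm_tsum_sub_trapezoidal_le {g : ℝ → ℂ} {A R : ℝ} {n : ℕ} (hn : 2 ≤ n) (hR : 0 < R)
    (hA : 0 ≤ A) (hg : ∀ x, ‖g x‖ ≤ A * Real.exp (-x ^ 2)) :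
    ‖((2 * R / ((n : ℝ) - 1) : ℝ) : ℂ) * ∑' k : ℤ, g (-R + 2 * R / ((n : ℝ) - 1) * k) -
        onInterval (trapezoidal n) R g‖ ≤
      A * Real.exp (1 / 2) * Real.exp (-(R ^ 2 / 2)) * ((2 * R / ((n : ℝ) - 1)) *
        (2 / (1 - Real.exp (-((2 * R / ((n : ℝ) - 1)) / 2))))) := by
  classical
  have hn1 : (0 : ℝ) < (n : ℝ) - 1 := by
    have : (2 : ℝ) ≤ n := by exact_mod_cast hn
    linarith
  set h := 2 * R / ((n : ℝ) - 1) with hh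
  have hh0 : 0 < h := by positivity
  have hRh : h * ((n : ℝ) - 1) = 2 * R := by rw [hh]; field_simp
  set φ : ℤ → ℂ := fun k => g (-R + h * k) with hφ
  set w : ℤ → ℝ := fun k => if 0 ≤ k ∧ k < n then (if k = 0 ∨ k = n - 1 then 1 / 2 else 1) else 0
    with hw
  have hw01 : ∀ k, 0 ≤ w k ∧ w k ≤ 1 := by
    intro k; simp only [hw]; split_ifs <;> norm_num
  have htrap : onInterval (trapezoidal n) R g = h * ∑' k : ℤ, (w k : ℂ) * φ k := by
    have hsupp : ∀ k ∉ (Finset.range n).map Nat.castEmbedding, (w k : ℂ) * φ k = 0 := by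
      intro k hk
      have : ¬ (0 ≤ k ∧ k < n) := by
        rintro ⟨h1, h2⟩
        apply hk
        rw [Finset.mem_map]
        exact ⟨k.toNat, by rw [Finset.mem_range]; omega, by simp [h1]⟩
      simp only [hw]
      rw [if_neg this]; simp
    rw [tsum_eq_sum hsupp, Finset.sum_map, onInterval, trapezoidal, Finset.smul_sum, Finset.mul_sum]
    refine Finset.sum_congr rfl fun j hj => ?_
    rw [Finset.mem_range] at hj
    have hwj : w (j : ℤ) = if j = 0 ∨ j = n - 1 then (1 / 2 : ℝ) else 1 := by
      simp only [hw]
      rw [if_pos ⟨by omega, by omega⟩]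
      congr 1
      apply propext
      omega
    have hx : R * (-1 + (j : ℝ) * (2 / ((n : ℝ) - 1))) = -R + h * j := by
      rw [hh]; ring
    simp only [Nat.castEmbedding_apply, hφ, Int.cast_natCast]
    rw [hwj, hx, Complex.real_smul, Complex.real_smul, ← mul_assoc, ← mul_assoc,
      ← Complex.ofReal_mul, ← Complex.ofReal_mul, ← mul_assoc, hh]
    congr 3
    ring
  have hwsum : Summable fun k : ℤ => (w k : ℂ) * φ k := by
    refine summable_of_hasFiniteSupport ((Set.finite_Ico (0 : ℤ) n).subset fun k hk => ?_)
    by_contra hk'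
    apply hk
    rw [Set.mem_Ico] at hk'
    simp only [hw]
    rw [if_neg hk']; simp
  set r := Real.exp (-(h / 2)) with hr
  have hr1 : r < 1 := by rw [hr, Real.exp_lt_one_iff]; linarith
  set B := A * Real.exp (1 / 2) * Real.exp (-(R ^ 2 / 2)) with hB
  have hd : ∀ k : ℤ, ‖((1 - w k : ℝ) : ℂ) * φ k‖ ≤ B * r ^ k.natAbs := by
    intro k
    by_cases hk : 0 < k ∧ k < n - 1
    · have : w k = 1 := by
        simp only [hw]
        rw [if_pos ⟨by omega, by omega⟩, if_neg (by omega)]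
      rw [this, sub_self, Complex.ofReal_zero, zero_mul, norm_zero]
      positivity
    -- The omitted nodes, including the omitted halves at the end points, satisfy `|y| ≥ R` and `|y|
    -- ≥ h|k|/2`. Half of `y²` gives `e^{-R²/2}`; the other half, by `y²/2 ≥ |y| - 1/2`, gives a
    -- geometric series and the factor `e^{1/2}`.
    · have habs : R ≤ |-R + h * k| ∧ h * k.natAbs / 2 ≤ |-R + h * k| := by
        rw [Nat.cast_natAbs]
        push_cast
        rcases le_or_gt k 0 with hk0 | hk0
        · have hk0' : (k : ℝ) ≤ 0 := by exact_mod_cast hk0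
          have : h * k ≤ 0 := mul_nonpos_of_nonneg_of_nonpos hh0.le hk0'
          rw [abs_of_nonpos hk0', abs_of_nonpos (by linarith : -R + h * k ≤ 0)]
          constructor <;> linarith
        · have hk1 : (n : ℝ) - 1 ≤ k := by
            have : (n : ℤ) - 1 ≤ k := by omega
            exact_mod_cast this
          have : h * ((n : ℝ) - 1) ≤ h * k := by gcongr
          rw [abs_of_nonneg (by linarith : (0 : ℝ) ≤ k), abs_of_nonneg (by linarith)]
          constructor <;> linarith
      set y := -R + h * k
      have h1 : R ^ 2 ≤ y ^ 2 := by
        rw [← sq_abs y]; gcongr; exact habs.1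
      have h2 : h * k.natAbs / 2 - 1 / 2 ≤ y ^ 2 / 2 := by
        rw [← sq_abs y]
        nlinarith [sq_nonneg (|y| - 1), habs.2]
      calc ‖((1 - w k : ℝ) : ℂ) * φ k‖ ≤ 1 * (A * Real.exp (-y ^ 2)) := by
            rw [norm_mul, Complex.norm_real, Real.norm_eq_abs]
            refine mul_le_mul ?_ (hg y) (norm_nonneg _) zero_le_one
            rw [abs_le]
            constructor <;> linarith [hw01 k]
        _ ≤ A * (Real.exp (1 / 2) * Real.exp (-(R ^ 2 / 2)) * r ^ k.natAbs) := by
            rw [one_mul, hr, ← Real.exp_nat_mul, ← Real.exp_add, ← Real.exp_add]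
            gcongr
            linarith
        _ = B * r ^ k.natAbs := by rw [hB]; ring
  have hgeo := (hasSum_int_geometric (Real.exp_nonneg _) hr1).summable
  have hdsum : Summable fun k : ℤ => ((1 - w k : ℝ) : ℂ) * φ k :=
    Summable.of_norm_bounded (hgeo.mul_left B) hd
  have hsplit : ∑' k : ℤ, φ k = ∑' k : ℤ, ((1 - w k : ℝ) : ℂ) * φ k + ∑' k : ℤ, (w k : ℂ) * φ k := by
    rw [← hdsum.tsum_add hwsum]
    refine tsum_congr fun k => ?_
    push_cast
    ring
  rw [htrap, ← mul_sub, hsplit, add_sub_cancel_right, norm_mul, Complex.norm_real,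
    Real.norm_of_nonneg hh0.le]
  calc _ ≤ h * (B * ∑' k : ℤ, r ^ k.natAbs) := by
        gcongr
        rw [← tsum_mul_left]
        exact tsum_of_norm_bounded (hgeo.mul_left B).hasSum hd
    _ ≤ h * (B * (2 / (1 - r))) := by
        gcongr
        exact tsum_int_geometric_le (Real.exp_nonneg _) hr1
    _ = _ := by ring

end

/-! ### Truncation and the rate `exp (-C n ^ (2 / 3))` -/

theorem norm_integral_sub_intervalIntegral_le {g : ℝ → ℂ} {A R : ℝ} (hgc : Continuous g)
    (hR : 0 ≤ R) (hg : ∀ x, ‖g x‖ ≤ A * Real.exp (-x ^ 2)) :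
    ‖(∫ x : ℝ, g x) - ∫ x in (-R)..R, g x‖ ≤
      A * √(2 * Real.pi) * Real.exp (-(R ^ 2 / 2)) := by
  have hA : 0 ≤ A := by simpa using (norm_nonneg _).trans (hg 0)
  have hi : Integrable g := ((integrable_exp_neg_mul_sq one_pos).const_mul A).mono'
    hgc.aestronglyMeasurable (Eventually.of_forall fun x => by simpa using hg x)
  have hi2 : Integrable fun x : ℝ => A * Real.exp (-(R ^ 2 / 2)) * Real.exp (-(1 / 2) * x ^ 2) :=
    (integrable_exp_neg_mul_sq (by norm_num)).const_mul _
  rw [intervalIntegral.integral_of_le (by linarith), ← integral_add_compl measurableSet_Ioc hi,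
    add_sub_cancel_left]
  calc _ ≤ ∫ x in (Set.Ioc (-R) R)ᶜ,
        A * Real.exp (-(R ^ 2 / 2)) * Real.exp (-(1 / 2) * x ^ 2) := by
        refine norm_integral_le_of_norm_le hi2.integrableOn
          ((ae_restrict_iff' measurableSet_Ioc.compl).2 (Eventually.of_forall fun x hx => ?_))
        refine (hg x).trans ?_
        rw [mul_assoc, ← Real.exp_add]
        gcongr
        have : R ≤ |x| := by
          by_contra! h
          rw [abs_lt] at h
          exact hx ⟨h.1, h.2.le⟩
        have : R ^ 2 ≤ x ^ 2 := by rw [← sq_abs x]; gcongr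
        linarith
    _ ≤ ∫ x, A * Real.exp (-(R ^ 2 / 2)) * Real.exp (-(1 / 2) * x ^ 2) :=
        setIntegral_le_integral hi2 (Eventually.of_forall fun x => by positivity)
    _ = _ := by
        rw [integral_const_mul, integral_gaussian, show Real.pi / (1 / 2) = 2 * Real.pi by ring]
        ring

theorem tendsto_natCast_rpow_atTop {p : ℝ} (hp : 0 < p) :
    Tendsto (fun n : ℕ => (n : ℝ) ^ p) atTop atTop :=
  (tendsto_rpow_atTop hp).comp tendsto_natCast_atTop_atTop

theorem isBigO_exp_neg_mul_mono {c C : ℝ} (h : C ≤ c) :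
    (fun n : ℕ => Real.exp (-c * (n : ℝ) ^ (2 / 3 : ℝ))) =O[atTop]
      fun n : ℕ => Real.exp (-C * (n : ℝ) ^ (2 / 3 : ℝ)) := by
  refine IsBigO.of_bound' (Eventually.of_forall fun n => ?_)
  rw [Real.norm_of_nonneg (Real.exp_nonneg _), Real.norm_of_nonneg (Real.exp_nonneg _)]
  gcongr

theorem sq_natCast_rpow_one_third (n : ℕ) :
    ((n : ℝ) ^ (1 / 3 : ℝ)) ^ 2 = (n : ℝ) ^ (2 / 3 : ℝ) := by
  rw [← Real.rpow_natCast, ← Real.rpow_mul (Nat.cast_nonneg n)]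
  norm_num

theorem natCast_eq_rpow_mul (n : ℕ) :
    (n : ℝ) = (n : ℝ) ^ (2 / 3 : ℝ) * (n : ℝ) ^ (1 / 3 : ℝ) := by
  rw [← Real.rpow_add_of_nonneg (Nat.cast_nonneg n) (by norm_num) (by norm_num)]
  norm_num

theorem natCast_sq_eq_rpow_pow (n : ℕ) : (n : ℝ) ^ 2 = ((n : ℝ) ^ (2 / 3 : ℝ)) ^ 3 := by
  rw [← Real.rpow_natCast (_ ^ _), ← Real.rpow_mul (Nat.cast_nonneg n)]
  norm_num

/-- Convergence at the rate `exp (-C n ^ (2 / 3))` of `n`-point interpolatory rules with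
polynomially bounded sums of absolute values of the weights. -/
theorem isBigO_interpolatory_error {G : ℂ → ℂ} {a M L : ℝ} (ha : 0 < a) (hL : 0 < L)
    (hG : DifferentiableOn ℂ G {z : ℂ | |z.im| < a}) (hM : ∀ z : ℂ, |z.im| < a → ‖G z‖ ≤ M)
    (hreal : ∀ x : ℝ, ‖G x‖ ≤ M * Real.exp (-x ^ 2)) (s : ℕ → Finset ℝ)
    (hs : ∀ n, 2 ≤ n → (s n).card = n ∧ (∀ x ∈ s n, x ∈ Set.Icc (-1 : ℝ) 1) ∧
      ∑ x ∈ s n, |∫ t in (-1 : ℝ)..1, (Lagrange.basis (s n) id x).eval t| ≤ 2 * (n : ℝ) ^ 2) :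
    (fun n : ℕ => (∫ x : ℝ, G x) - onInterval (interpolatory (s n)) (L * (n : ℝ) ^ (1 / 3 : ℝ))
      fun x : ℝ => G x) =O[atTop]
      fun n : ℕ => Real.exp (-min (L ^ 2 / 2) (a / (8 * L)) * (n : ℝ) ^ (2 / 3 : ℝ)) := by
  have hM0 : 0 ≤ M := (norm_nonneg _).trans (hM 0 (by simpa using ha))
  have hcont : Continuous fun x : ℝ => G x :=
    hG.continuousOn.comp_continuous Complex.continuous_ofReal fun x => by simpa using ha
  have h1 : (fun n : ℕ => M * √(2 * Real.pi) * Real.exp (-(L ^ 2 / 2) * (n : ℝ) ^ (2 / 3 : ℝ)))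
      =O[atTop] fun n : ℕ =>
        Real.exp (-min (L ^ 2 / 2) (a / (8 * L)) * (n : ℝ) ^ (2 / 3 : ℝ)) :=
    (isBigO_exp_neg_mul_mono (min_le_left _ _)).const_mul_left _
  -- With `x = n^{2/3}`, the weights contribute `n² = x³` and `R² = L² x`, whence `x⁴`. Halving the
  -- rate from `a/(4L)` to `a/(8L)` absorbs it.
  have h2 : (fun n : ℕ => 16 * M / a * 4 * L ^ 2 *
      (((n : ℝ) ^ (2 / 3 : ℝ)) ^ 4 * Real.exp (-(a / (4 * L)) * (n : ℝ) ^ (2 / 3 : ℝ))))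
      =O[atTop] fun n : ℕ =>
        Real.exp (-min (L ^ 2 / 2) (a / (8 * L)) * (n : ℝ) ^ (2 / 3 : ℝ)) := by
    refine IsBigO.const_mul_left (IsBigO.trans ?_ (isBigO_exp_neg_mul_mono (min_le_right _ _))) _
    have h := ((isLittleO_pow_exp_pos_mul_atTop 4 (b := a / (8 * L)) (by positivity)).isBigO.comp_tendsto
      (tendsto_natCast_rpow_atTop (p := 2 / 3) (by norm_num))).mul
      (isBigO_refl (fun n : ℕ => Real.exp (-(a / (4 * L)) * (n : ℝ) ^ (2 / 3 : ℝ))) atTop)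
    refine h.congr (fun n => rfl) fun n => ?_
    simp only [Function.comp]
    rw [← Real.exp_add]
    congr 1
    field_simp
    ring
  refine IsBigO.trans (IsBigO.of_bound' ?_) (h1.add h2)
  filter_upwards [eventually_ge_atTop 2,
    (tendsto_natCast_rpow_atTop (p := 1 / 3) (by norm_num)).eventually_ge_atTop (a / L),
    (tendsto_natCast_rpow_atTop (p := 2 / 3) (by norm_num)).eventually_ge_atTop 1] with n hn hna hx
  obtain ⟨hcard, hIcc, hW⟩ := hs n hn
  set R := L * (n : ℝ) ^ (1 / 3 : ℝ) with hR
  set x := (n : ℝ) ^ (2 / 3 : ℝ) with hxdef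
  have haR : a ≤ R := by rwa [div_le_iff₀' hL] at hna
  have hR0 : 0 < R := ha.trans_le haR
  have hR2 : R ^ 2 = L ^ 2 * x := by rw [hR, mul_pow, sq_natCast_rpow_one_third]
  have e1 := norm_integral_sub_intervalIntegral_le hcont hR0.le hreal
  have e2 := norm_integral_sub_onInterval_le ha haR hG hM hIcc (by positivity) hW
  have hexp : -(a / (4 * R)) * (s n).card = -(a / (4 * L)) * x := by
    have h3 : 0 < (n : ℝ) ^ (1 / 3 : ℝ) := pos_of_mul_pos_right hR0 hL.le
    rw [hcard, hR]
    nth_rewrite 2 [natCast_eq_rpow_mul n]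
    rw [← hxdef]
    field_simp
  have hW' : (2 + 2 * (n : ℝ) ^ 2) ≤ 4 * x ^ 3 := by
    rw [natCast_sq_eq_rpow_pow]
    have : 1 ≤ x ^ 3 := one_le_pow₀ hx
    linarith
  rw [hexp] at e2
  rw [← sub_add_sub_cancel _ (∫ x in (-R)..R, G x) _]
  refine ((norm_add_le _ _).trans (add_le_add e1 e2)).trans (le_trans ?_ (le_abs_self _))
  refine add_le_add (le_of_eq ?_) ?_
  · rw [hR2]; congr 2; ring
  · rw [hR2]
    calc _ ≤ 16 * M / a * (4 * x ^ 3) * (L ^ 2 * x) * Real.exp (-(a / (4 * L)) * x) := by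
          gcongr
      _ = _ := by ring

/-- The step is `h = 2R/(n - 1) ≤ 4L n^{-2/3}`, since `n - 1 ≥ n/2`. Hence `e^{-πβ/h}` has rate at
least `πβ/(4L)`, while the nodes outside `[-R, R]` cost `e^{-R²/2}`, of rate `L²/2`. -/
theorem isBigO_trapezoidal_error {G : ℂ → ℂ} {A β L : ℝ} (hβ : 0 < β) (hL : 0 < L)
    (hG : DifferentiableOn ℂ G {z : ℂ | |z.im| ≤ β})
    (hGA : ∀ z : ℂ, |z.im| ≤ β → ‖G z‖ ≤ A * Real.exp (-z.re ^ 2 / 2))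
    (hreal : ∀ x : ℝ, ‖G x‖ ≤ A * Real.exp (-x ^ 2)) :
    (fun n : ℕ => (∫ x : ℝ, G x) - onInterval (trapezoidal n) (L * (n : ℝ) ^ (1 / 3 : ℝ))
      fun x : ℝ => G x) =O[atTop]
      fun n : ℕ => Real.exp (-min (L ^ 2 / 2) (Real.pi * β / (4 * L)) * (n : ℝ) ^ (2 / 3 : ℝ)) := by
  have hA : 0 ≤ A := by simpa using (norm_nonneg _).trans (hreal 0)
  set p := Real.pi * β / (4 * L) with hp
  have hp0 : 0 < p := by have := Real.pi_pos; positivity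
  have h1 : (fun n : ℕ => A * √(2 * Real.pi) * 4 * Real.exp (-p * (n : ℝ) ^ (2 / 3 : ℝ)))
      =O[atTop] fun n : ℕ => Real.exp (-min (L ^ 2 / 2) p * (n : ℝ) ^ (2 / 3 : ℝ)) :=
    (isBigO_exp_neg_mul_mono (min_le_right _ _)).const_mul_left _
  have h2 : (fun n : ℕ => A * Real.exp (1 / 2) * 8 *
      Real.exp (-(L ^ 2 / 2) * (n : ℝ) ^ (2 / 3 : ℝ)))
      =O[atTop] fun n : ℕ => Real.exp (-min (L ^ 2 / 2) p * (n : ℝ) ^ (2 / 3 : ℝ)) :=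
    (isBigO_exp_neg_mul_mono (min_le_left _ _)).const_mul_left _
  refine IsBigO.trans (IsBigO.of_bound' ?_) (h1.add h2)
  filter_upwards [eventually_ge_atTop 2,
    (tendsto_natCast_rpow_atTop (p := 2 / 3) (by norm_num)).eventually_ge_atTop (4 * L),
    (tendsto_natCast_rpow_atTop (p := 2 / 3) (by norm_num)).eventually_ge_atTop (1 / p)]
    with n hn hx hxp
  have hn2 : (2 : ℝ) ≤ n := by exact_mod_cast hn
  set R := L * (n : ℝ) ^ (1 / 3 : ℝ) with hR
  set x := (n : ℝ) ^ (2 / 3 : ℝ) with hxdef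
  have h3 : 0 < (n : ℝ) ^ (1 / 3 : ℝ) := Real.rpow_pos_of_pos (by linarith) _
  have hR0 : 0 < R := mul_pos hL h3
  have hx0 : 0 < x := Real.rpow_pos_of_pos (by linarith) _
  have hR2 : R ^ 2 = L ^ 2 * x := by rw [hR, mul_pow, sq_natCast_rpow_one_third]
  set h := 2 * R / ((n : ℝ) - 1) with hh
  have hh0 : 0 < h := div_pos (by linarith) (by linarith)
  have hhx : h ≤ 4 * L / x := by
    rw [hh, div_le_div_iff₀ (by linarith) hx0, hR]
    have := natCast_eq_rpow_mul n
    rw [← hxdef] at this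
    calc 2 * (L * (n : ℝ) ^ (1 / 3 : ℝ)) * x = 2 * L * n := by linear_combination (-2 * L) * this
      _ ≤ 2 * L * (2 * (n - 1)) := by gcongr; linarith
      _ = _ := by ring
  have hh1 : h ≤ 1 := hhx.trans (by rwa [div_le_one hx0])
  have hpx : p * x ≤ Real.pi * (β / h) := by
    have h4 : x / (4 * L) ≤ 1 / h := by
      rw [div_le_div_iff₀ (by positivity) hh0]
      rw [le_div_iff₀ hx0] at hhx
      linarith
    calc p * x = Real.pi * β * (x / (4 * L)) := by rw [hp]; ring
      _ ≤ Real.pi * β * (1 / h) := by have := Real.pi_pos; gcongr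
      _ = _ := by ring
  have e1 := norm_tsum_sub_integral_le hβ hh0 hG hGA (-R)
  have e2 := norm_tsum_sub_trapezoidal_le (g := fun x : ℝ => G x) hn hR0 hA hreal
  rw [← hh] at e2
  set E := Real.exp (-(Real.pi * (β / h))) with hE
  have hE1 : E ≤ Real.exp (-p * x) := Real.exp_le_exp.2 (by linarith)
  have hE2 : E ≤ 1 / 2 := by
    have h5 : 1 ≤ p * x := by
      rw [div_le_iff₀ hp0] at hxp
      linarith
    have h6 := Real.add_one_le_exp (Real.pi * (β / h))
    rw [hE, Real.exp_neg, inv_le_comm₀ (Real.exp_pos _) (by norm_num)]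
    norm_num
    linarith
  have e3 : A * √(2 * Real.pi) * E * (2 / (1 - E)) ≤
      A * √(2 * Real.pi) * 4 * Real.exp (-p * x) := by
    have : 2 / (1 - E) ≤ 4 := by
      rw [div_le_iff₀ (by linarith)]
      linarith
    have : 0 ≤ 2 / (1 - E) := div_nonneg zero_le_two (by linarith)
    calc _ ≤ A * √(2 * Real.pi) * Real.exp (-p * x) * 4 := by gcongr
      _ = _ := by ring
  have e4 : A * Real.exp (1 / 2) * Real.exp (-(R ^ 2 / 2)) *
      (h * (2 / (1 - Real.exp (-(h / 2))))) ≤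
      A * Real.exp (1 / 2) * 8 * Real.exp (-(L ^ 2 / 2) * x) := by
    have : h * (2 / (1 - Real.exp (-(h / 2)))) ≤ 8 := by
      calc _ ≤ h * (8 / h) := by gcongr h * ?_; exact exp_half_geometric_le hh0 hh1
        _ = 8 := by field_simp
    calc _ ≤ A * Real.exp (1 / 2) * Real.exp (-(R ^ 2 / 2)) * 8 := by gcongr
      _ = _ := by
        rw [hR2, show -(L ^ 2 * x / 2) = -(L ^ 2 / 2) * x by ring]
        ring
  refine (norm_sub_le_norm_sub_add_norm_sub _
    ((h : ℂ) * ∑' k : ℤ, G ((-R + h * k : ℝ) : ℂ)) _).trans (le_trans ?_ (le_abs_self _))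
  rw [norm_sub_rev]
  exact add_le_add (e1.trans e3) (e2.trans e4)

end TruncatedQuadrature

theorem theorem1 (f : ℝ → ℂ) (hf_an : AnalyticOnNhd ℝ f Set.univ)
    (hf_bdd : ∃ M : ℝ, ∀ x : ℝ, ‖f x‖ ≤ M)
    (a : ℝ) (ha : 0 < a)
    (h_ext : ∃ G : ℂ → ℂ,
      AnalyticOnNhd ℂ G {z : ℂ | |z.im| < a} ∧
      (∃ M : ℝ, ∀ z : ℂ, |z.im| < a → ‖G z‖ ≤ M) ∧
      ∀ x : ℝ, G (x : ℂ) = Real.exp (-x ^ 2) • f x)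
    (L : ℝ) (hL : 0 < L) :
    ∃ C : ℝ, 0 < C ∧
      ∀ Q : ℕ → (ℝ → ℂ) → ℂ,
        (Q = TruncatedQuadrature.gaussLegendre ∨ Q = TruncatedQuadrature.clenshawCurtis ∨
          Q = TruncatedQuadrature.trapezoidal) →
        (fun n : ℕ =>
          (∫ x : ℝ, Real.exp (-x ^ 2) • f x) -
            TruncatedQuadrature.onInterval (Q n) (L * (n : ℝ) ^ (1 / 3 : ℝ))
              (fun x : ℝ => Real.exp (-x ^ 2) • f x))
          =O[atTop] fun n : ℕ => Real.exp (-C * (n : ℝ) ^ (2 / 3 : ℝ)) := by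
  obtain ⟨G, hGan, ⟨M₁, hM₁⟩, hGf⟩ := h_ext
  obtain ⟨M₂, hM₂⟩ := hf_bdd
  set M := max M₁ M₂
  have hG : DifferentiableOn ℂ G {z : ℂ | |z.im| < a} := hGan.differentiableOn
  have hM : ∀ z : ℂ, |z.im| < a → ‖G z‖ ≤ M := fun z hz => (hM₁ z hz).trans (le_max_left _ _)
  have hM0 : 0 ≤ M := (norm_nonneg _).trans (hM 0 (by simpa using ha))
  have hreal : ∀ x : ℝ, ‖G x‖ ≤ M * Real.exp (-x ^ 2) := by
    intro x
    rw [hGf, norm_smul, Real.norm_of_nonneg (Real.exp_nonneg _), mul_comm]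
    gcongr
    exact (hM₂ x).trans (le_max_right _ _)
  have hpi := Real.pi_pos
  simp_rw [← hGf]
  refine ⟨min (min (L ^ 2 / 2) (a / (8 * L))) (min (L ^ 2 / 2) (Real.pi * (a / 4) / (4 * L))),
    by positivity, fun Q hQ => ?_⟩
  rcases hQ with rfl | rfl | rfl
  · refine (TruncatedQuadrature.isBigO_interpolatory_error ha hL hG hM hreal
      (fun n => (TruncatedQuadrature.legendre n).roots.toFinset) fun n hn => ?_).trans
      (TruncatedQuadrature.isBigO_exp_neg_mul_mono (min_le_left _ _))
    refine ⟨TruncatedQuadrature.card_roots_legendre n,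
      fun x => TruncatedQuadrature.legendre_roots_mem_Icc, ?_⟩
    rw [TruncatedQuadrature.sum_abs_weights_gaussLegendre (by omega)]
    have : (1 : ℝ) ≤ (n : ℝ) ^ 2 := one_le_pow₀ (by exact_mod_cast (by omega : 1 ≤ n))
    linarith
  · exact (TruncatedQuadrature.isBigO_interpolatory_error ha hL hG hM hreal
      TruncatedQuadrature.chebyshevPoints fun n hn =>
        ⟨TruncatedQuadrature.card_chebyshevPoints hn,
          fun x => TruncatedQuadrature.chebyshevPoints_mem_Icc,
          TruncatedQuadrature.sum_abs_weights_clenshawCurtis_le hn⟩).trans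
      (TruncatedQuadrature.isBigO_exp_neg_mul_mono (min_le_left _ _))
  -- The Gaussian bound is used with `b = a/2`, so it holds for `|Im z| ≤ a/4` with constant `M
  -- e^{(a/2)²}`.
  · refine (TruncatedQuadrature.isBigO_trapezoidal_error (A := M * Real.exp ((a / 2) ^ 2))
      (β := a / 4) (by linarith) hL (hG.mono fun z hz => ?_) (fun z hz => ?_) fun x => ?_).trans
      (TruncatedQuadrature.isBigO_exp_neg_mul_mono (min_le_right _ _))
    · have hz' : |z.im| ≤ a / 4 := hz
      exact lt_of_le_of_lt hz' (by linarith)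
    · exact TruncatedQuadrature.norm_le_of_gaussian_on_real (by linarith) (by linarith) hG hM hreal
        (by linarith)
    · refine (hreal x).trans ?_
      gcongr
      exact le_mul_of_one_le_right hM0 (Real.one_le_exp (by positivity))
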